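/- Let $f\in C^\infty(\mathbb R)$ satisfy $f>0$ on $\mathbb R$ and $f(x)=|x|^{-2}$ for all $|x|\ge 1$. Let $M=S^1\times\mathbb R$, $S^1=\mathbb R/2\pi\mathbb Z$, with the Riemannian metric $g=f(x)\,d\theta^2+dx^2$. Use the indices $1,2$ for the variables $x,\theta$, and put $R_{ijkl}=\langle(\nabla_i\nabla_j-\nabla_j\nabla_i)\partial_k,\partial_l\rangle$. Let $|Rm|^2=\frac12 g^{ia}g^{jb}g^{kc}g^{ld}R_{ijkl}R_{abcd}$, so that here $|Rm|^2=2(g^{11}g^{22}R_{1212})^2$. Then: (1) $(M,g)$ is complete. (2) For $|x|\ge1$ one has $R_{1212}=2/x^4$ and $|Rm|^2=8/x^4$ (so the contraction over all indices, without the factor $\frac12$, is $16/x^4$). The curvature is bounded: $|Rm|\le k_0$ on $M$ for some constant $k_0>0$. (3) The injectivity radius $\mathrm{inj}(x,\theta)$ tends to $0$ as $|x|\to\infty$ (uniformly in $\theta$). (4) Green–Wu smoothing with admissible radii need not give uniformly bounded derivatives of order $k$, for any $k\ge 1$. Precisely, for a smooth $\psi:\mathbb R\to[0,\infty)$ supported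 in $[-1,1]$, constant near $0$, with $\int_{\mathbb R^2}\psi(|v|)\,dv=1$, and for a continuous $u:M\to\mathbb R$, let $$u_\varepsilon(p)=\frac1{\varepsilon^2}\int_{T_pM}u(\exp_p v)\,\psi(|v|/\varepsilon)\,d\Omega_p ,\qquad \varepsilon>0 .$$ For every integer $k\ge1$ there are a bounded continuous function $u$ on $M$, which is moreover $1$-Lipschitz for the Riemannian distance if $k\ge 2$, and points $p_j=(x_j,\theta_j)\in M$ with $|x_j|\to\infty$ and $\mathrm{inj}(p_j)>0$, such that for every such $\psi$ and every $C\in\mathbb R$, for all sufficiently large $j$ and all $\varepsilon$ with $0<2\varepsilon<\mathrm{inj}(p_j)$, the function $u_\varepsilon$ is smooth near $p_j$ and $|\nabla^k u_\varepsilon|(p_j)>C$. -/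

import Mathlib

open Set Filter Topology MeasureTheory
open scoped ENNReal NNReal ContDiff

noncomputable section

namespace Cyl

/-- The cylinder `S¹ × ℝ`, with `S¹ = ℝ / 2πℤ`; a point is `(θ, x)`. -/
abbrev M : Type := AddCircle (2 * Real.pi) × ℝ

/-- Coordinate vectors: index `0` is the variable `x`, index `1` is the variable `θ`. They are used
both for coordinates of points and for components of tangent vectors in the global smooth frame
`∂/∂x, ∂/∂θ` of `M`. -/
abbrev Coord : Type := Fin 2 → ℝ

/-- The (universal) covering map `ℝ² → S¹ × ℝ`, `(x, θ) ↦ (θ mod 2π, x)`. Its local inverses are the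
standard local coordinates `(x, θ)` of the manifold `S¹ × ℝ`. -/
def cov (y : Coord) : M := ((y 1 : AddCircle (2 * Real.pi)), y 0)

/-- The admissible functions `f`: smooth, positive, and equal to `|x|⁻²` for `|x| ≥ 1`. -/
structure IsProfile (f : ℝ → ℝ) : Prop where
  smooth : ContDiff ℝ ∞ f
  pos : ∀ x, 0 < f x
  eq_far : ∀ x, 1 ≤ |x| → f x = |x| ^ (-2 : ℤ)

/-- The components of the metric `g = f(x) dθ² + dx²` at a point of `M`. -/
def metric (f : ℝ → ℝ) (p : M) : Matrix (Fin 2) (Fin 2) ℝ := !![1, 0; 0, f p.2]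

/-- The length `|v|` of the tangent vector at `p` with components `v`. -/
def vnorm (f : ℝ → ℝ) (p : M) (v : Coord) : ℝ :=
  Real.sqrt (∑ i, ∑ j, metric f p i j * v i * v j)

/-- The components `g_ij` in the local coordinates `y = (x, θ)`. -/
def gLow (f : ℝ → ℝ) (i j : Fin 2) (y : Coord) : ℝ := metric f (cov y) i j

/-- The components `g^ij` of the inverse metric. -/
def gUp (f : ℝ → ℝ) (i j : Fin 2) (y : Coord) : ℝ := (metric f (cov y))⁻¹ i j

/-- The partial derivative `∂F/∂yⁱ`. -/
def pd (i : Fin 2) (F : Coord → ℝ) (y : Coord) : ℝ := fderiv ℝ F y (Pi.single i 1)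

/-- The Christoffel symbol `Γᵏ_ij` of the Levi-Civita connection. -/
def Gam (f : ℝ → ℝ) (k i j : Fin 2) (y : Coord) : ℝ :=
  1 / 2 * ∑ l, gUp f k l y *
    (pd i (gLow f j l) y + pd j (gLow f i l) y - pd l (gLow f i j) y)

/-- The component `Rˡ` along `∂_l` of `(∇_i ∇_j - ∇_j ∇_i) ∂_k`. -/
def Rup (f : ℝ → ℝ) (i j k l : Fin 2) (y : Coord) : ℝ :=
  pd i (Gam f l j k) y - pd j (Gam f l i k) y
    + ∑ m, (Gam f m j k y * Gam f l i m y - Gam f m i k y * Gam f l j m y)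

/-- `R_ijkl = ⟨(∇_i ∇_j - ∇_j ∇_i) ∂_k, ∂_l⟩`. -/
def Rlow (f : ℝ → ℝ) (i j k l : Fin 2) (y : Coord) : ℝ :=
  ∑ m, Rup f i j k m y * gLow f m l y

/-- The full contraction `g^{ia} g^{jb} g^{kc} g^{ld} R_ijkl R_abcd`, over all indices. -/
def rmFullSq (f : ℝ → ℝ) (y : Coord) : ℝ :=
  ∑ i, ∑ j, ∑ k, ∑ l, ∑ a, ∑ b, ∑ c, ∑ d,
    gUp f i a y * gUp f j b y * gUp f k c y * gUp f l d y * Rlow f i j k l y * Rlow f a b c d y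

/-- `|Rm|²`, in the normalization in which `Rm` is a 2-form with values in the endomorphisms of
the tangent bundle: in an orthonormal frame `∑_{i<j} ∑_{k,l} R_ijkl²`, that is one half of the
contraction over all indices. On a surface, in orthogonal coordinates, this is
`2 (g¹¹ g²² R_1212)²`. -/
def rmSq (f : ℝ → ℝ) (y : Coord) : ℝ := 1 / 2 * rmFullSq f y

/-- The Riemannian distance: the infimum of the lengths of `C¹` curves from `p` to `q`. A curve in
`M` is given by its lift to `ℝ²`. -/
def rdist (f : ℝ → ℝ) (p q : M) : ℝ :=
  sInf {L : ℝ | ∃ c : ℝ → Coord, ContDiff ℝ 1 c ∧ cov (c 0) = p ∧ cov (c 1) = q ∧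
    L = ∫ t in (0 : ℝ)..1, vnorm f (cov (c t)) (deriv c t)}

/-- Every sequence which is Cauchy for the Riemannian distance converges for it. -/
def IsCompleteMetric (f : ℝ → ℝ) : Prop :=
  ∀ s : ℕ → M, (∀ e > 0, ∃ N, ∀ m ≥ N, ∀ n ≥ N, rdist f (s m) (s n) < e) →
    ∃ p : M, Tendsto (fun n => rdist f (s n) p) atTop (𝓝 0)

/-- `q` is the value at time `1` of a geodesic `[0, 1] → M` (written in coordinates as `c`, with
velocity `w`) which starts at `p` with velocity `v`. -/
def IsExp (f : ℝ → ℝ) (p : M) (v : Coord) (q : M) : Prop :=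
  ∃ c w : ℝ → Coord,
    (∀ t ∈ Icc (0 : ℝ) 1, HasDerivWithinAt c (w t) (Icc 0 1) t ∧
      HasDerivWithinAt w (fun k => -∑ i, ∑ j, Gam f k i j (c t) * w t i * w t j) (Icc 0 1) t) ∧
    cov (c 0) = p ∧ w 0 = v ∧ cov (c 1) = q

open Classical in
/-- The exponential map `exp_p` (with value `p` where it is not defined). -/
def expMap (f : ℝ → ℝ) (p : M) (v : Coord) : M :=
  if h : ∃ q, IsExp f p v q then h.choose else p

/-- The open ball of radius `r` about `0` in `T_p M`. -/
def tball (f : ℝ → ℝ) (p : M) (r : ℝ) : Set Coord := {v | vnorm f p v < r}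

/-- `exp_p` is defined on the ball of radius `r` in `T_p M` and is a diffeomorphism of it onto its
image: it is injective, and it is smooth with invertible differential (`E` is `exp_p` written in
the coordinates of the covering plane; a smooth map from a ball to `M` lifts to the plane). -/
def ExpDiffeoOn (f : ℝ → ℝ) (p : M) (r : ℝ) : Prop :=
  (∀ v ∈ tball f p r, ∃ q, IsExp f p v q) ∧
  InjOn (expMap f p) (tball f p r) ∧
  ∃ E : Coord → Coord, ContDiffOn ℝ ∞ E (tball f p r) ∧
    ∀ v ∈ tball f p r, cov (E v) = expMap f p v ∧ Function.Bijective (fderiv ℝ E v)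

/-- The injectivity radius at `p`. -/
def injRad (f : ℝ → ℝ) (p : M) : ℝ≥0∞ :=
  ⨆ (r : ℝ≥0) (_ : ExpDiffeoOn f p r), (r : ℝ≥0∞)

/-- The kernels of the Riemannian convolution on surfaces: smooth, nonnegative, supported in
`[-1, 1]`, constant near `0`, with `∫_{ℝ²} ψ(|v|) dv = 1`. -/
structure IsKernel (ψ : ℝ → ℝ) : Prop where
  smooth : ContDiff ℝ ∞ ψ
  nonneg : ∀ t, 0 ≤ ψ t
  supp : tsupport ψ ⊆ Icc (-1) 1
  const_near : ∀ᶠ t in 𝓝 (0 : ℝ), ψ t = ψ 0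
  mass : ∫ v : EuclideanSpace ℝ (Fin 2), ψ ‖v‖ = 1

/-- The Green–Wu smoothing
`u_ε(p) = ε⁻² ∫_{T_p M} u(exp_p v) ψ(|v|/ε) dΩ_p`, where `dΩ_p = √(det g) dv` in components. -/
def greenWu (f ψ : ℝ → ℝ) (u : M → ℝ) (ε : ℝ) (p : M) : ℝ :=
  (ε ^ 2)⁻¹ * ∫ v : Coord,
    u (expMap f p v) * ψ (vnorm f p v / ε) * Real.sqrt (metric f p).det

/-- The components of the `k`-th covariant derivative `∇ᵏ h` of a function `h` on `M`. -/
def covDeriv (f : ℝ → ℝ) (h : M → ℝ) : (k : ℕ) → (Fin k → Fin 2) → Coord → ℝ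
  | 0, _, y => h (cov y)
  | k + 1, I, y => pd (I 0) (covDeriv f h k (Fin.tail I)) y
      - ∑ s : Fin k, ∑ m, Gam f m (I 0) (I s.succ) y *
          covDeriv f h k (Function.update (Fin.tail I) s m) y

/-- The norm `|∇ᵏ h|` with respect to `g`. -/
def covDerivNorm (f : ℝ → ℝ) (h : M → ℝ) (k : ℕ) (y : Coord) : ℝ :=
  Real.sqrt (∑ I : Fin k → Fin 2, ∑ J : Fin k → Fin 2,
    (∏ s, gUp f (I s) (J s) y) * covDeriv f h k I y * covDeriv f h k J y)

end Cyl

end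

/-!
Every assertion comes down to explicit geodesics. Where `|x| ≥ 1` the metric is `x⁻² dθ² + dx²`, the
quantity `L = θ' / x²` is constant along a geodesic, and the geodesic equation becomes the linear
equation `x'' = -L² x` together with `θ' = L x²`. This gives closed formulas for geodesics
(`farGeod`) and for the exponential map (`farExp`, `isExp_farExp`) in terms of entire functions of
the initial velocity, so no theory of smooth dependence of flows is needed. Uniqueness for the
geodesic equation identifies the formulas with `expMap`.

Completeness: `x` is `1`-Lipschitz for the distance, and over a compact interval of `x` so is a
multiple of `θ`, hence a Cauchy sequence converges on the cylinder; the lengths of coordinate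
segments show that it converges for the distance as well. Curvature: the surface has the one
component `f · curv f`, which is computed from the Christoffel symbols.

Injectivity radius: the geodesics which leave `(X, θ)` in the two horizontal directions are mirror
images of each other and meet half-way around the circle, after a length of at most `3.2 / |X|`
(`injRad_le`). The radius is positive by the inverse function theorem applied to `farExp`
(`injRad_pos`).

Smoothings: the test function is `u = c f^(m/2) cos θ`, which is `c x⁻ᵐ cos θ` far out, with `m = 0`
for `k = 1` and `m = 1`, which makes it Lipschitz, for `k ≥ 2`. An admissible `ε` satisfies
`ε X ≤ 8/5`. In variables rescaled by `X`, with `δ = X⁻²`, the function `Xᵐ u ∘ exp` extends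
smoothly to `δ = 0` (`amp`), where it becomes `cos (θ + z₁)` on a flat cylinder. An average of this oscillation over a disc of radius `R = ε X ≤ 8/5` against a rotationally symmetric probability
density keeps a factor at least `1 - R²/4 > 0` (`le_integral_weight_cos`), whatever the density is.
Along a geodesic `γ` the ordinary `k`-th derivative of a function is `∇ᵏ(γ', …, γ')`
(`iteratedDeriv_along_geodesic`). For the geodesic of speed `1 / X` with velocity `∂/∂θ` at the
point, this derivative of `u_ε` is at least `c X⁻ᵐ / 4` for large `X`, by uniform convergence of the
derivatives as `δ → 0`. Hence `|∇ᵏ u_ε| ≥ c Xᵏ⁻ᵐ / 4`, which is unbounded because `m < k`.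
-/

noncomputable section

namespace Cyl

/-! ### Christoffel symbols and curvature -/

theorem pd_comp_x {g : ℝ → ℝ} (i : Fin 2) (y : Coord) (hg : DifferentiableAt ℝ g (y 0)) :
    pd i (fun z => g (z 0)) y = if i = 0 then deriv g (y 0) else 0 := by
  have h : HasFDerivAt (fun z : Coord => g (z 0))
      ((ContinuousLinearMap.toSpanSingleton ℝ (deriv g (y 0))).comp
        (ContinuousLinearMap.proj (R := ℝ) (φ := fun _ : Fin 2 => ℝ) 0)) y :=
    (hg.hasDerivAt.hasFDerivAt).comp y
      (ContinuousLinearMap.proj (R := ℝ) (φ := fun _ : Fin 2 => ℝ) 0).hasFDerivAt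
  rw [pd, h.fderiv]
  fin_cases i <;> simp

theorem pd_const (i : Fin 2) (a : ℝ) (y : Coord) : pd i (fun _ => a) y = 0 := by
  simp [pd]

section Curvature

variable {f : ℝ → ℝ}

theorem gLow_eq (i j : Fin 2) :
    gLow f i j = fun y => if i = j then (if i = 0 then 1 else f (y 0)) else 0 := by
  funext y
  fin_cases i <;> fin_cases j <;> simp [gLow, metric, cov]

theorem gUp_eq (hf : IsProfile f) (i j : Fin 2) (y : Coord) :
    gUp f i j y = if i = j then (if i = 0 then 1 else (f (y 0))⁻¹) else 0 := by
  have h := (hf.pos (y 0)).ne'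
  have : (metric f (cov y))⁻¹ = !![1, 0; 0, (f (y 0))⁻¹] := by
    apply Matrix.inv_eq_right_inv
    ext a b
    fin_cases a <;> fin_cases b <;> simp [metric, cov, Matrix.mul_apply, Fin.sum_univ_two, h]
  rw [gUp, this]
  fin_cases i <;> fin_cases j <;> simp

theorem IsProfile.differentiable (hf : IsProfile f) : Differentiable ℝ f :=
  hf.smooth.differentiable (by simp)

theorem IsProfile.deriv_smooth (hf : IsProfile f) : ContDiff ℝ ∞ (deriv f) :=
  ((contDiff_infty_iff_deriv (𝕜 := ℝ)).1 hf.smooth).2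

theorem pd_gLow (hf : IsProfile f) (l i j : Fin 2) (y : Coord) :
    pd l (gLow f i j) y = if l = 0 ∧ i = 1 ∧ j = 1 then deriv f (y 0) else 0 := by
  rw [gLow_eq]
  by_cases h : i = j
  · subst h
    fin_cases i
    · simp [pd_const]
    · simpa using pd_comp_x l y (hf.differentiable (y 0))
  · have : ¬ (l = 0 ∧ i = 1 ∧ j = 1) := by rintro ⟨-, rfl, rfl⟩; exact h rfl
    simp [h, this, pd_const]

/-- The Christoffel symbols of `f dθ² + dx²`: the nonzero ones are `Γˣ_θθ = -f'/2` and
`Γᶿ_xθ = Γᶿ_θx = f'/(2f)`. -/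
theorem Gam_eq (hf : IsProfile f) (k i j : Fin 2) :
    Gam f k i j = fun y => if k = 0 then (if i = 1 ∧ j = 1 then -deriv f (y 0) / 2 else 0)
      else (if i ≠ j then deriv f (y 0) / (2 * f (y 0)) else 0) := by
  funext y
  have h := (hf.pos (y 0)).ne'
  simp only [Gam, Fin.sum_univ_two, pd_gLow hf, gUp_eq hf]
  fin_cases k <;> fin_cases i <;> fin_cases j <;> simp <;> field_simp

/-- The negative of the Gauss curvature, `(f'/(2f))' + (f'/(2f))²`. -/
def curv (f : ℝ → ℝ) (x : ℝ) : ℝ :=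
  deriv (fun t => deriv f t / (2 * f t)) x + (deriv f x / (2 * f x)) ^ 2

theorem logDeriv_smooth (hf : IsProfile f) : ContDiff ℝ ∞ (fun t => deriv f t / (2 * f t)) :=
  hf.deriv_smooth.div (contDiff_const.mul hf.smooth) fun x => by
    have := hf.pos x; positivity

theorem continuous_curv (hf : IsProfile f) : Continuous (curv f) := by
  have h := logDeriv_smooth hf
  exact (((contDiff_infty_iff_deriv (𝕜 := ℝ)).1 h).2.continuous).add (h.continuous.pow 2)

theorem curv_eq (hf : IsProfile f) (x : ℝ) :
    curv f x = deriv (deriv f) x / (2 * f x) - (deriv f x) ^ 2 / (4 * f x ^ 2) := by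
  have h := (hf.pos x).ne'
  have h1 : HasDerivAt (fun t => deriv f t / (2 * f t)) _ x :=
    ((hf.deriv_smooth.differentiable (by simp)) x).hasDerivAt.div
      (((hf.differentiable x).hasDerivAt).const_mul 2) (by simpa using h)
  rw [curv, h1.deriv]
  field_simp
  ring

theorem pd_Gam (hf : IsProfile f) (l k i j : Fin 2) (y : Coord) :
    pd l (Gam f k i j) y = if l = 0 then
      (if k = 0 then (if i = 1 ∧ j = 1 then -deriv (deriv f) (y 0) / 2 else 0)
        else (if i ≠ j then deriv (fun t => deriv f t / (2 * f t)) (y 0) else 0)) else 0 := by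
  rw [Gam_eq hf]
  by_cases hk : k = 0
  · by_cases hij : i = 1 ∧ j = 1
    · simp only [hk, hij, if_true, and_self]
      rw [pd_comp_x (g := fun t => -deriv f t / 2) l y]
      · congr 1
        simp
      · exact ((hf.deriv_smooth.differentiable (by simp) _).neg).div_const 2
    · simp [hk, hij, pd_const]
  · by_cases hij : i ≠ j
    · simp only [hk, if_false, if_pos hij]
      rw [pd_comp_x (g := fun t => deriv f t / (2 * f t)) l y]
      · exact (logDeriv_smooth hf).differentiable (by simp) _
    · simp [hk, hij, pd_const]

/-- A surface has one curvature component, up to the symmetries of the curvature tensor. -/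
theorem Rlow_eq (hf : IsProfile f) (i j k l : Fin 2) (y : Coord) :
    Rlow f i j k l y = if i = j ∨ k = l then 0 else
      if i = k then f (y 0) * curv f (y 0) else -(f (y 0) * curv f (y 0)) := by
  have h := (hf.pos (y 0)).ne'
  have h2 : deriv (deriv f) (y 0) =
      2 * f (y 0) * (curv f (y 0) + (deriv f (y 0)) ^ 2 / (4 * f (y 0) ^ 2)) := by
    rw [curv_eq hf]; field_simp; ring
  have h3 : deriv (fun t => deriv f t / (2 * f t)) (y 0) =
      curv f (y 0) - (deriv f (y 0) / (2 * f (y 0))) ^ 2 := by rw [curv]; ring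
  simp only [Rlow, Rup, Fin.sum_univ_two, pd_Gam hf, gLow_eq]
  simp only [Gam_eq hf, h2, h3]
  fin_cases i <;> fin_cases j <;> fin_cases k <;> fin_cases l <;> simp <;> field_simp <;> ring

theorem rmFullSq_eq (hf : IsProfile f) (y : Coord) :
    rmFullSq f y = 4 * curv f (y 0) ^ 2 := by
  have h := (hf.pos (y 0)).ne'
  simp only [rmFullSq, gUp_eq hf, ite_mul, zero_mul, mul_ite, mul_zero, Finset.sum_ite_eq,
    Finset.mem_univ, if_true]
  simp only [Fin.sum_univ_two, Rlow_eq hf]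
  simp
  field_simp
  ring

/-- At `|x| = 1` the derivatives of `f` are one-sided derivatives of `x⁻²`. -/
theorem IsProfile.deriv_far (hf : IsProfile f) {x : ℝ} (hx : 1 ≤ |x|) :
    f x = (x ^ 2)⁻¹ ∧ deriv f x = -2 * (x ^ 3)⁻¹ ∧ deriv (deriv f) x = 6 * (x ^ 4)⁻¹ := by
  have key : ∀ s : Set ℝ, UniqueDiffOn ℝ s → (∀ z ∈ s, 1 ≤ |z|) → ∀ z ∈ s,
      f z = (z ^ 2)⁻¹ ∧ deriv f z = -2 * (z ^ 3)⁻¹ ∧ deriv (deriv f) z = 6 * (z ^ 4)⁻¹ := by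
    intro s hs h1
    have hne : ∀ z ∈ s, z ≠ 0 := by
      rintro z hz rfl
      have := h1 0 hz
      norm_num at this
    have e0 : ∀ z ∈ s, f z = (z ^ 2)⁻¹ := by
      intro z hz
      rw [hf.eq_far z (h1 z hz), zpow_neg]
      norm_cast
      rw [sq_abs]
    have e1 : ∀ z ∈ s, deriv f z = -2 * (z ^ 3)⁻¹ := by
      intro z hz
      have hz0 := hne z hz
      have a := (hf.differentiable z).hasDerivAt.hasDerivWithinAt (s := s)
      have b : HasDerivWithinAt (fun z : ℝ => (z ^ 2)⁻¹) _ s z :=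
        ((hasDerivAt_pow 2 z).inv (pow_ne_zero 2 hz0)).hasDerivWithinAt
      have c := b.congr e0 (e0 z hz)
      rw [(hs z hz).eq_deriv _ a c]
      field_simp
      norm_num
      ring
    refine fun z hz => ⟨e0 z hz, e1 z hz, ?_⟩
    have hz0 := hne z hz
    have a := ((hf.deriv_smooth.differentiable (by simp)) z).hasDerivAt.hasDerivWithinAt (s := s)
    have b : HasDerivWithinAt (fun z : ℝ => -2 * (z ^ 3)⁻¹) _ s z :=
      (((hasDerivAt_pow 3 z).inv (pow_ne_zero 3 hz0)).const_mul (-2)).hasDerivWithinAt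
    have c := b.congr e1 (e1 z hz)
    rw [(hs z hz).eq_deriv _ a c]
    field_simp
    norm_num
    ring
  rcases le_abs.1 hx with h | h
  · exact key (Ici 1) (uniqueDiffOn_Ici 1) (fun z hz => le_abs.2 (Or.inl hz)) x h
  · refine key (Iic (-1)) (uniqueDiffOn_Iic (-1)) (fun z hz => le_abs.2 (Or.inr ?_)) x ?_
    · have : z ≤ -1 := hz
      linarith
    · show x ≤ -1
      linarith

theorem ne_zero_of_one_le_abs {x : ℝ} (hx : 1 ≤ |x|) : x ≠ 0 := by
  rintro rfl
  norm_num at hx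

theorem curv_far (hf : IsProfile f) {x : ℝ} (hx : 1 ≤ |x|) : curv f x = 2 / x ^ 2 := by
  obtain ⟨h0, h1, h2⟩ := hf.deriv_far hx
  have := ne_zero_of_one_le_abs hx
  rw [curv_eq hf, h0, h1, h2]
  field_simp
  ring

theorem curvature_far (hf : IsProfile f) (y : Coord) (hy : 1 ≤ |y 0|) :
    Rlow f 0 1 0 1 y = 2 / y 0 ^ 4 ∧ rmSq f y = 8 / y 0 ^ 4 ∧ rmFullSq f y = 16 / y 0 ^ 4 := by
  have h0 := (hf.deriv_far hy).1
  have h := ne_zero_of_one_le_abs hy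
  refine ⟨?_, ?_, ?_⟩
  · rw [Rlow_eq hf, curv_far hf hy, h0]
    simp
    field_simp
  · rw [rmSq, rmFullSq_eq hf, curv_far hf hy]
    field_simp
    norm_num
  · rw [rmFullSq_eq hf, curv_far hf hy]
    field_simp
    norm_num

theorem exists_bound_of_bound_far {g : ℝ → ℝ} (hg : Continuous g) {B : ℝ}
    (hB : ∀ x, 1 ≤ |x| → |g x| ≤ B) : ∃ C, 0 < C ∧ ∀ x, |g x| ≤ C := by
  obtain ⟨C, hC⟩ := (isCompact_Icc (a := (-1 : ℝ)) (b := 1)).exists_bound_of_continuousOn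
    hg.continuousOn
  refine ⟨max 1 (max B C), by positivity, fun x => ?_⟩
  rcases le_total 1 |x| with h | h
  · exact (hB x h).trans (by simp)
  · exact (hC x (abs_le.1 h)).trans (by simp)

theorem curvature_bounded (hf : IsProfile f) :
    ∃ k₀ : ℝ, 0 < k₀ ∧ ∀ y : Coord, Real.sqrt (rmSq f y) ≤ k₀ := by
  obtain ⟨C, hC, h⟩ := exists_bound_of_bound_far (continuous_curv hf) (B := 2) (by
    intro x hx
    rw [curv_far hf hx, abs_div, abs_pow, abs_two]
    have : 1 ≤ |x| ^ 2 := one_le_pow₀ hx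
    exact div_le_self (by norm_num) this)
  refine ⟨2 * C, by positivity, fun y => Real.sqrt_le_iff.2 ⟨by positivity, ?_⟩⟩
  rw [rmSq, rmFullSq_eq hf]
  have := sq_le_sq' (abs_le.1 (h (y 0))).1 (abs_le.1 (h (y 0))).2
  nlinarith [sq_nonneg C]

end Curvature

/-! ### Riemannian distance and completeness -/

theorem vnorm_eq (f : ℝ → ℝ) (y v : Coord) :
    vnorm f (cov y) v = Real.sqrt (v 0 ^ 2 + f (y 0) * v 1 ^ 2) := by
  simp [vnorm, metric, cov, Fin.sum_univ_two]
  ring_nf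

theorem exists_cov (p : M) : ∃ y : Coord, cov y = p := by
  obtain ⟨a, x⟩ := p
  obtain ⟨t, rfl⟩ := QuotientAddGroup.mk_surjective a
  exact ⟨![x, t], rfl⟩

theorem isOpenMap_cov : IsOpenMap cov := by
  have h : cov = (Prod.map ((↑) : ℝ → AddCircle (2 * Real.pi)) id) ∘
      (fun y : Coord => (y 1, y 0)) := rfl
  rw [h]
  refine IsOpenMap.comp (QuotientAddGroup.isOpenMap_coe.prodMap IsOpenMap.id) ?_
  let e : Coord ≃ₜ ℝ × ℝ :=
    { toFun := fun y => (y 1, y 0)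
      invFun := fun q => ![q.2, q.1]
      left_inv := fun y => by ext i; fin_cases i <;> rfl
      right_inv := fun q => rfl
      continuous_toFun := by fun_prop
      continuous_invFun := by
        refine continuous_pi fun i => ?_
        fin_cases i
        · exact continuous_snd
        · exact continuous_fst }
  exact e.isOpenMap

section Distance

variable {f : ℝ → ℝ}

theorem continuous_vnorm (hf : IsProfile f) {c w : ℝ → Coord} (hc : Continuous c)
    (hw : Continuous w) : Continuous fun t => vnorm f (cov (c t)) (w t) := by
  simp only [vnorm_eq]
  have := hf.smooth.continuous
  fun_prop

theorem vnorm_nonneg (f : ℝ → ℝ) (p : M) (v : Coord) : 0 ≤ vnorm f p v := Real.sqrt_nonneg _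

/-- The lengths of the `C¹` curves from `p` to `q`. -/
def lengths (f : ℝ → ℝ) (p q : M) : Set ℝ :=
  {L : ℝ | ∃ c : ℝ → Coord, ContDiff ℝ 1 c ∧ cov (c 0) = p ∧ cov (c 1) = q ∧
    L = ∫ t in (0 : ℝ)..1, vnorm f (cov (c t)) (deriv c t)}

theorem nonneg_of_mem_lengths {p q : M} {L : ℝ} (h : L ∈ lengths f p q) : 0 ≤ L := by
  obtain ⟨c, -, -, -, rfl⟩ := h
  exact intervalIntegral.integral_nonneg (by norm_num) fun t _ => vnorm_nonneg _ _ _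

theorem bddBelow_lengths (p q : M) : BddBelow (lengths f p q) :=
  ⟨0, fun _ h => nonneg_of_mem_lengths h⟩

theorem rdist_nonneg (p q : M) : 0 ≤ rdist f p q :=
  Real.sInf_nonneg fun _ h => nonneg_of_mem_lengths h

/-- The coordinate segment from `y` to `z`, as a curve. -/
def segCurve (y z : Coord) (t : ℝ) : Coord := y + t • (z - y)

theorem contDiff_segCurve (y z : Coord) : ContDiff ℝ 1 (segCurve y z) :=
  contDiff_const.add (contDiff_id.smul contDiff_const)

theorem deriv_segCurve (y z : Coord) (t : ℝ) : deriv (segCurve y z) t = z - y := by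
  have h : HasDerivAt (segCurve y z) ((1 : ℝ) • (z - y)) t :=
    ((hasDerivAt_id t).smul_const (z - y)).const_add y
  simpa using h.deriv

theorem segCurve_mem_lengths (y z : Coord) :
    (∫ t in (0 : ℝ)..1, vnorm f (cov (segCurve y z t)) (z - y)) ∈
      lengths f (cov y) (cov z) :=
  ⟨segCurve y z, contDiff_segCurve y z, by simp [segCurve], by simp [segCurve],
    by simp only [deriv_segCurve]⟩

theorem lengths_nonempty (p q : M) : (lengths f p q).Nonempty := by
  obtain ⟨y, rfl⟩ := exists_cov p
  obtain ⟨z, rfl⟩ := exists_cov q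
  exact ⟨_, segCurve_mem_lengths y z⟩

/-- A function whose derivative along a curve is bounded by the speed of the curve changes by at
most the length of the curve. -/
theorem abs_sub_le_integral_vnorm (hf : IsProfile f) {c : ℝ → Coord} (hc : ContDiff ℝ 1 c)
    {g g' : ℝ → ℝ} (hg : ∀ t, HasDerivAt g (g' t) t) (hg' : Continuous g') {a : ℝ} (ha : 0 ≤ a)
    (hle : ∀ t ∈ Icc 0 a, |g' t| ≤ vnorm f (cov (c t)) (deriv c t)) :
    |g a - g 0| ≤ ∫ t in (0 : ℝ)..a, vnorm f (cov (c t)) (deriv c t) := by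
  rw [← intervalIntegral.integral_eq_sub_of_hasDerivAt (fun t _ => hg t)
    (hg'.intervalIntegrable 0 a)]
  refine (intervalIntegral.abs_integral_le_integral_abs ha).trans ?_
  refine intervalIntegral.integral_mono_on ha (hg'.abs.intervalIntegrable 0 a) ?_ hle
  exact (continuous_vnorm hf hc.continuous (hc.continuous_deriv le_rfl)).intervalIntegrable 0 a

theorem hasDerivAt_coord {c : ℝ → Coord} (hc : ContDiff ℝ 1 c) (t : ℝ) (i : Fin 2) :
    HasDerivAt (fun s => c s i) (deriv c t i) t :=
  (hasDerivAt_pi.1 (hc.differentiable (by simp) t).hasDerivAt) i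

theorem abs_x_le_vnorm (hf : IsProfile f) (y v : Coord) : |v 0| ≤ vnorm f (cov y) v := by
  rw [vnorm_eq]
  apply Real.abs_le_sqrt
  have := mul_nonneg (hf.pos (y 0)).le (sq_nonneg (v 1))
  linarith

theorem abs_θ_le_vnorm {y v : Coord} {m : ℝ} (hm : m ^ 2 ≤ f (y 0)) :
    |m * v 1| ≤ vnorm f (cov y) v := by
  rw [vnorm_eq]
  apply Real.abs_le_sqrt
  have := mul_le_mul_of_nonneg_right hm (sq_nonneg (v 1))
  nlinarith [sq_nonneg (v 0)]

/-- On a partial curve the variable `x` moves by at most the whole length. -/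
theorem abs_x_sub_le (hf : IsProfile f) {c : ℝ → Coord} (hc : ContDiff ℝ 1 c) {a : ℝ}
    (ha : a ∈ Icc (0 : ℝ) 1) :
    |c a 0 - c 0 0| ≤ ∫ t in (0 : ℝ)..1, vnorm f (cov (c t)) (deriv c t) := by
  have hcont := continuous_vnorm hf hc.continuous (hc.continuous_deriv le_rfl)
  refine (abs_sub_le_integral_vnorm hf hc (g := fun t => c t 0)
    (fun t => hasDerivAt_coord hc t 0) ?_ ha.1 fun t _ => abs_x_le_vnorm hf _ _).trans ?_
  · exact (continuous_apply 0).comp (hc.continuous_deriv le_rfl)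
  · rw [← intervalIntegral.integral_add_adjacent_intervals
      (hcont.intervalIntegrable 0 a) (hcont.intervalIntegrable a 1)]
    have := intervalIntegral.integral_nonneg (μ := volume) ha.2
      fun t _ => vnorm_nonneg f (cov (c t)) (deriv c t)
    linarith

theorem exists_sq_le_of_profile (hf : IsProfile f) (R : ℝ) :
    ∃ m : ℝ, 0 < m ∧ ∀ x ∈ Icc (-R) R, m ^ 2 ≤ f x := by
  rcases (Icc (-R) R).eq_empty_or_nonempty with h | h
  · exact ⟨1, one_pos, by simp [h]⟩
  · obtain ⟨x₀, -, hx₀⟩ := isCompact_Icc.exists_isMinOn h hf.smooth.continuous.continuousOn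
    refine ⟨Real.sqrt (f x₀), Real.sqrt_pos.2 (hf.pos x₀), fun x hx => ?_⟩
    rw [Real.sq_sqrt (hf.pos x₀).le]
    exact hx₀ hx

theorem abs_snd_sub_le_rdist (hf : IsProfile f) (p q : M) : |p.2 - q.2| ≤ rdist f p q := by
  refine le_csInf (lengths_nonempty p q) ?_
  rintro L ⟨c, hc, rfl, rfl, rfl⟩
  have := abs_x_sub_le hf hc (a := 1) (by simp)
  rw [abs_sub_comm]
  exact this

/-- Near a circle `x = const`, the variable `θ` is controlled by the distance: short curves stay in
a compact part of `M`, on which `f` has a positive lower bound. -/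
theorem dist_fst_le_of_rdist_lt (hf : IsProfile f) {R m e : ℝ} (hm : 0 < m)
    (hmf : ∀ x ∈ Icc (-(R + 1)) (R + 1), m ^ 2 ≤ f x) {p q : M} (hp : |p.2| ≤ R)
    (he1 : e ≤ 1) (h : rdist f p q < e) : dist p.1 q.1 ≤ e / m := by
  obtain ⟨L, hL, hLe⟩ := exists_lt_of_csInf_lt (lengths_nonempty p q) h
  obtain ⟨c, hc, rfl, rfl, rfl⟩ := hL
  have hin : ∀ t ∈ Icc (0 : ℝ) 1, m ^ 2 ≤ f (c t 0) := by
    intro t ht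
    apply hmf
    have h1 := abs_x_sub_le hf hc ht
    have h2 : |c 0 0| ≤ R := hp
    rw [abs_le] at h1 h2
    constructor <;> linarith
  have hθ : |m * c 1 1 - m * c 0 1| ≤ ∫ t in (0 : ℝ)..1, vnorm f (cov (c t)) (deriv c t) := by
    refine abs_sub_le_integral_vnorm hf hc (g := fun t => m * c t 1)
      (fun t => (hasDerivAt_coord hc t 1).const_mul m) ?_ zero_le_one
      fun t ht => abs_θ_le_vnorm (hin t ht)
    exact continuous_const.mul ((continuous_apply 1).comp (hc.continuous_deriv le_rfl))
  rw [← mul_sub, abs_mul, abs_of_pos hm] at hθ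
  have hn : dist (cov (c 0)).1 (cov (c 1)).1 ≤ |c 1 1 - c 0 1| := by
    rw [dist_comm, dist_eq_norm]
    show ‖((c 1 1 : ℝ) : AddCircle (2 * Real.pi)) - (c 0 1 : ℝ)‖ ≤ _
    rw [← AddCircle.coe_sub]
    exact QuotientAddGroup.norm_mk_le_norm
  refine hn.trans ?_
  rw [le_div_iff₀ hm]
  linarith

/-- The Riemannian distance induces a topology which is not finer than the usual one. -/
theorem tendsto_rdist_nhds (hf : IsProfile f) (p : M) :
    Tendsto (fun q => rdist f q p) (𝓝 p) (𝓝 0) := by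
  obtain ⟨z, rfl⟩ := exists_cov p
  refine Tendsto.mono_left ?_ (isOpenMap_cov.nhds_le z)
  rw [tendsto_map'_iff]
  let G : Coord × ℝ → ℝ := fun q => vnorm f (cov (segCurve q.1 z q.2)) (z - q.1)
  have hG : Continuous G := by
    have h0 := hf.smooth.continuous
    have h1 : G = fun q => Real.sqrt ((z - q.1) 0 ^ 2 +
        f ((q.1 + q.2 • (z - q.1)) 0) * (z - q.1) 1 ^ 2) := by
      funext q; simp only [G, vnorm_eq]; rfl
    rw [h1]
    fun_prop
  have hI : Continuous fun y : Coord => ∫ t in (0 : ℝ)..1, G (y, t) :=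
    intervalIntegral.continuous_parametric_intervalIntegral_of_continuous'
      (f := fun y t => G (y, t)) hG 0 1
  have h0 : (∫ t in (0 : ℝ)..1, G (z, t)) = 0 := by simp [G, vnorm]
  have ht := hI.tendsto z
  rw [h0] at ht
  refine squeeze_zero (fun y => rdist_nonneg _ _) (fun y => ?_) ht
  exact csInf_le (bddBelow_lengths _ _) (segCurve_mem_lengths y z)

theorem isCompleteMetric (hf : IsProfile f) : IsCompleteMetric f := by
  intro s hs
  have : Fact (0 < 2 * Real.pi) := ⟨by positivity⟩
  obtain ⟨N₀, hN₀⟩ := hs 1 one_pos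
  set R := |(s N₀).2| + 1
  have hR : ∀ n ≥ N₀, |(s n).2| ≤ R := by
    intro n hn
    have h1 := (abs_snd_sub_le_rdist hf (s n) (s N₀)).trans (hN₀ n hn N₀ le_rfl).le
    have h2 := abs_sub_abs_le_abs_sub (s n).2 (s N₀).2
    simp only [R]
    linarith
  obtain ⟨m, hm, hmf⟩ := exists_sq_le_of_profile hf (R + 1)
  have hcauchy : CauchySeq s := by
    rw [Metric.cauchySeq_iff]
    intro e he
    -- `e' ≤ 1` keeps the curves over `|x| ≤ R + 1`, where `m² ≤ f`
    set e' := min 1 (min (e / 2) (e / 2 * m))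
    have he' : 0 < e' := by positivity
    obtain ⟨N, hN⟩ := hs e' he'
    refine ⟨max N N₀, fun a ha b hb => ?_⟩
    have hab := hN a ((le_max_left _ _).trans ha) b ((le_max_left _ _).trans hb)
    have h1 := dist_fst_le_of_rdist_lt hf hm hmf (hR a ((le_max_right _ _).trans ha))
      (min_le_left _ _) hab
    have h2 : e' / m ≤ e / 2 := by
      rw [div_le_iff₀ hm]
      exact (min_le_right _ _).trans (min_le_right _ _)
    have h3 := (abs_snd_sub_le_rdist hf (s a) (s b)).trans_lt hab
    have h4 : e' ≤ e / 2 := (min_le_right _ _).trans (min_le_left _ _)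
    rw [Prod.dist_eq, Real.dist_eq]
    refine max_lt ?_ ?_ <;> linarith
  obtain ⟨p, hp⟩ := cauchySeq_tendsto_of_complete hcauchy
  exact ⟨p, (tendsto_rdist_nhds hf p).comp hp⟩

end Distance

/-! ### Geodesics and the exponential map in the region `|x| ≥ 1` -/

section Geodesics

variable {f : ℝ → ℝ}

/-- The acceleration `-Γᵏ_ij wⁱ wʲ` of a geodesic at the point `y` with velocity `w`. -/
def acc (f : ℝ → ℝ) (y w : Coord) : Coord := fun k => -∑ i, ∑ j, Gam f k i j y * w i * w j

theorem acc_eq (hf : IsProfile f) (y w : Coord) :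
    acc f y w = ![deriv f (y 0) / 2 * w 1 ^ 2, -(deriv f (y 0) / f (y 0)) * (w 0 * w 1)] := by
  have h := (hf.pos (y 0)).ne'
  ext k
  fin_cases k
  · simp [acc, Gam_eq hf, Fin.sum_univ_two]
    ring
  · simp [acc, Gam_eq hf, Fin.sum_univ_two]
    field_simp
    ring

theorem acc_far (hf : IsProfile f) {y : Coord} (hy : 1 ≤ |y 0|) (w : Coord) :
    acc f y w = ![-(w 1 ^ 2 / y 0 ^ 3), 2 / y 0 * (w 0 * w 1)] := by
  obtain ⟨h0, h1, -⟩ := hf.deriv_far hy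
  have h := ne_zero_of_one_le_abs hy
  rw [acc_eq hf, h0, h1]
  ext k
  fin_cases k
  · simp
    field_simp
  · simp
    left
    field_simp

/-- The geodesic spray, a vector field on the tangent bundle. -/
def spray (f : ℝ → ℝ) (q : Coord × Coord) : Coord × Coord := (q.2, acc f q.1 q.2)

theorem contDiff_spray (hf : IsProfile f) : ContDiff ℝ ∞ (spray f) := by
  refine contDiff_snd.prodMk (contDiff_pi.2 fun k => ?_)
  have h1 := hf.smooth
  have h2 := hf.deriv_smooth
  have c0 : ContDiff ℝ ∞ fun q : Coord × Coord => q.1 0 := by fun_prop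
  have h3 : ContDiff ℝ ∞ fun q : Coord × Coord => deriv f (q.1 0) / f (q.1 0) :=
    (h2.comp c0).div (h1.comp c0) fun q => (hf.pos _).ne'
  have h4 : ContDiff ℝ ∞ fun q : Coord × Coord => deriv f (q.1 0) := h2.comp c0
  simp only [acc_eq hf]
  fin_cases k
  · simp only [Fin.zero_eta, Matrix.cons_val_zero]
    fun_prop
  · simp only [Fin.mk_one, Matrix.cons_val_one, Matrix.cons_val_fin_one]
    fun_prop

/-- Solutions of the geodesic equation with equal initial data agree. -/
theorem spray_unique (hf : IsProfile f) {g h : ℝ → Coord × Coord}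
    (hg : ∀ t ∈ Icc (0 : ℝ) 1, HasDerivWithinAt g (spray f (g t)) (Icc 0 1) t)
    (hh : ∀ t ∈ Icc (0 : ℝ) 1, HasDerivWithinAt h (spray f (h t)) (Icc 0 1) t)
    (h0 : g 0 = h 0) : EqOn g h (Icc 0 1) := by
  have cg : ContinuousOn g (Icc 0 1) := fun t ht => (hg t ht).continuousWithinAt
  have ch : ContinuousOn h (Icc 0 1) := fun t ht => (hh t ht).continuousWithinAt
  obtain ⟨r, hr⟩ := ((isCompact_Icc.image_of_continuousOn cg).union
    (isCompact_Icc.image_of_continuousOn ch)).isBounded.subset_closedBall 0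
  obtain ⟨K, hK⟩ : ∃ K, LipschitzOnWith K (spray f) (Metric.closedBall 0 r) :=
    (contDiff_spray hf).contDiffOn.exists_lipschitzOnWith (by simp) (convex_closedBall 0 r)
      (isCompact_closedBall 0 r)
  have key : ∀ {g : ℝ → Coord × Coord},
      (∀ t ∈ Icc (0 : ℝ) 1, HasDerivWithinAt g (spray f (g t)) (Icc 0 1) t) →
      ∀ t ∈ Ico (0 : ℝ) 1, HasDerivWithinAt g (spray f (g t)) (Ici t) t := by
    intro g hg t ht
    have h1 : HasDerivWithinAt g (spray f (g t)) (Icc t 1) t :=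
      (hg t (Ico_subset_Icc_self ht)).mono (Icc_subset_Icc_left ht.1)
    exact h1.mono_of_mem_nhdsWithin (Icc_mem_nhdsGE ht.2)
  exact ODE_solution_unique_of_mem_Icc_right (v := fun _ => spray f)
    (s := fun _ => Metric.closedBall 0 r) (fun _ _ => hK) cg (key hg)
    (fun t ht => hr (Or.inl (mem_image_of_mem g (Ico_subset_Icc_self ht)))) ch (key hh)
    (fun t ht => hr (Or.inr (mem_image_of_mem h (Ico_subset_Icc_self ht)))) h0

theorem cov_eq_iff {y z : Coord} :
    cov y = cov z ↔ y 0 = z 0 ∧ ∃ n : ℤ, z 1 - y 1 = n * (2 * Real.pi) := by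
  rw [cov, cov, Prod.mk.injEq, and_comm]
  refine and_congr Iff.rfl ?_
  rw [eq_comm, ← sub_eq_zero, ← AddCircle.coe_sub, AddCircle.coe_eq_zero_iff]
  constructor
  · rintro ⟨n, h⟩
    exact ⟨n, by rw [← h, zsmul_eq_mul]⟩
  · rintro ⟨n, h⟩
    exact ⟨n, by rw [h, zsmul_eq_mul]⟩

theorem IsExp.unique (hf : IsProfile f) {p : M} {v : Coord} {q q' : M} (h : IsExp f p v q)
    (h' : IsExp f p v q') : q = q' := by
  obtain ⟨c, w, hcw, h0, hw, h1⟩ := h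
  obtain ⟨c', w', hcw', h0', hw', h1'⟩ := h'
  -- the two lifts differ by a deck transformation
  set d : Coord := c 0 - c' 0 with hd
  obtain ⟨hx, n, hn⟩ := cov_eq_iff.1 (h0'.trans h0.symm)
  have hd0 : d 0 = 0 := by simp [hd, hx]
  have hd1 : d 1 = n * (2 * Real.pi) := by simp [hd, hn]
  have hacc : ∀ y w, acc f (y + d) w = acc f y w := by
    intro y w
    simp [acc_eq hf, hd0]
  have e := spray_unique hf (g := fun t => (c t, w t)) (h := fun t => (c' t + d, w' t))
    (fun t ht => (hcw t ht).1.prodMk (hcw t ht).2)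
    (fun t ht => by
      have := ((hcw' t ht).1.add_const d).prodMk (hcw' t ht).2
      simp only [spray, hacc]
      exact this)
    (by simp [hd, hw, hw'])
  have e1 : c 1 = c' 1 + d := congrArg Prod.fst (e (right_mem_Icc.2 zero_le_one))
  rw [← h1, ← h1', e1, eq_comm, cov_eq_iff]
  exact ⟨by simp [hd0], n, by simp [hd1]⟩

theorem expMap_eq (hf : IsProfile f) {p : M} {v : Coord} {q : M} (h : IsExp f p v q) :
    expMap f p v = q := by
  have hex : ∃ q, IsExp f p v q := ⟨q, h⟩
  rw [expMap, dif_pos hex]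
  exact hex.choose_spec.unique hf h

/-- The point at time `t` of the geodesic of the metric `x⁻² dθ² + dx²` which starts at `(X, θ)`
with velocity `(a, L X²)`. The quantity `L = θ' / x²` is constant along geodesics, and `x'' = -L² x`
and `θ' = L x²`. -/
def farGeod (X θ a L t : ℝ) : Coord :=
  ![X * Real.cos (L * t) + a / L * Real.sin (L * t),
    θ + (a ^ 2 * (L * t - Real.sin (L * t) * Real.cos (L * t)) / (2 * L ^ 2)
      + X * a * Real.sin (L * t) ^ 2 / L
      + X ^ 2 * (L * t + Real.cos (L * t) * Real.sin (L * t)) / 2)]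

/-- The velocity of `farGeod`. -/
def farVel (X a L t : ℝ) : Coord :=
  ![-(X * L) * Real.sin (L * t) + a * Real.cos (L * t),
    L * (X * Real.cos (L * t) + a / L * Real.sin (L * t)) ^ 2]

theorem hasDerivAt_farGeod (X θ a t : ℝ) {L : ℝ} (hL : L ≠ 0) :
    HasDerivAt (farGeod X θ a L) (farVel X a L t) t := by
  have hlin : HasDerivAt (fun t => L * t) L t := by
    simpa using (hasDerivAt_id t).const_mul L
  have hs := hlin.sin
  have hc := hlin.cos
  rw [hasDerivAt_pi]
  intro i
  fin_cases i
  · refine ((hc.const_mul X).add (hs.const_mul (a / L))).congr_deriv ?_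
    simp [farVel]
    field_simp
  · refine ((((((hlin.sub (hs.mul hc)).const_mul (a ^ 2)).div_const (2 * L ^ 2)).add
      (((hs.pow 2).const_mul (X * a)).div_const L)).add
      (((hlin.add (hc.mul hs)).const_mul (X ^ 2)).div_const 2)).const_add θ).congr_deriv ?_
    simp only [farVel, Fin.mk_one, Matrix.cons_val_one, Matrix.cons_val_fin_one]
    field_simp
    have h1 := Real.sin_sq_add_cos_sq (L * t)
    have h2 : Real.sin (L * t) ^ 2 = 1 - Real.cos (L * t) ^ 2 := by linarith
    simp only [Nat.cast_ofNat, Nat.add_one_sub_one, pow_one]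
    ring_nf
    simp only [h2]
    ring

theorem hasDerivAt_farVel (hf : IsProfile f) (X θ a : ℝ) {L t : ℝ} (hL : L ≠ 0)
    (hfar : 1 ≤ |farGeod X θ a L t 0|) :
    HasDerivAt (farVel X a L) (acc f (farGeod X θ a L t) (farVel X a L t)) t := by
  rw [acc_far hf hfar]
  have hlin : HasDerivAt (fun t => L * t) L t := by
    simpa using (hasDerivAt_id t).const_mul L
  have hs := hlin.sin
  have hc := hlin.cos
  have hx := ne_zero_of_one_le_abs hfar
  have hx' : X * Real.cos (L * t) + a / L * Real.sin (L * t) ≠ 0 := hx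
  rw [hasDerivAt_pi]
  intro i
  fin_cases i
  · refine ((hs.const_mul (-(X * L))).add (hc.const_mul a)).congr_deriv ?_
    simp [farVel, farGeod]
    field_simp
    ring
  · refine ((((hc.const_mul X).add (hs.const_mul (a / L))).pow 2).const_mul L).congr_deriv ?_
    simp [farVel, farGeod]
    field_simp

end Geodesics

section Sinc

open Real

theorem analyticOnNhd_dslope {g : ℝ → ℝ} (hg : AnalyticOnNhd ℝ g univ) (a : ℝ) :
    AnalyticOnNhd ℝ (dslope g a) univ := by
  intro x _
  rcases eq_or_ne x a with rfl | h
  · obtain ⟨p, hp⟩ := hg x trivial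
    exact ⟨_, hp.has_fpower_series_dslope_fslope⟩
  · have h1 : AnalyticAt ℝ (fun y => (y - a)⁻¹ * (g y - g a)) x :=
      ((analyticAt_id.sub analyticAt_const).inv (sub_ne_zero.2 h)).mul
        ((hg x trivial).sub analyticAt_const)
    refine h1.congr ?_
    filter_upwards [isOpen_ne.mem_nhds h] with y hy
    rw [dslope_of_ne _ hy, slope, smul_eq_mul, vsub_eq_sub]

theorem analytic_sinc : AnalyticOnNhd ℝ sinc univ := by
  rw [sinc_eq_dslope]
  exact analyticOnNhd_dslope (fun x _ => Real.analyticAt_sin) 0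

/-- The entire function `(L - sin L cos L) / (2 L²)`. -/
def sincQ : ℝ → ℝ := dslope (fun L => -(1 / 2) * sinc (2 * L)) 0

theorem analytic_sincQ : AnalyticOnNhd ℝ sincQ univ := by
  refine analyticOnNhd_dslope (fun x _ => ?_) 0
  exact analyticAt_const.mul ((analytic_sinc _ trivial).comp (analyticAt_const.mul analyticAt_id))

theorem contDiff_sinc : ContDiff ℝ ∞ sinc :=
  contDiff_iff_contDiffAt.2 fun x => (analytic_sinc x trivial).contDiffAt

theorem contDiff_sincQ : ContDiff ℝ ∞ sincQ :=
  contDiff_iff_contDiffAt.2 fun x => (analytic_sincQ x trivial).contDiffAt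

theorem sincQ_of_ne_zero {L : ℝ} (h : L ≠ 0) :
    sincQ L = (L - sin L * cos L) / (2 * L ^ 2) := by
  rw [sincQ, dslope_of_ne _ h, slope, smul_eq_mul, vsub_eq_sub, sinc_of_ne_zero (by simpa using h)]
  simp [sin_two_mul]
  field_simp
  ring

theorem deriv_sinc_zero : deriv sinc 0 = 0 := by
  have h := (contDiff_sinc.differentiable (by simp) 0).hasDerivAt
  have h2 : HasDerivAt (fun x : ℝ => sinc (-x)) (deriv sinc 0 * -1) 0 := by
    have h3 : HasDerivAt sinc (deriv sinc 0) (-0) := by simpa using h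
    exact h3.comp 0 (hasDerivAt_neg (0 : ℝ))
  simp only [sinc_neg] at h2
  have := h.unique h2
  linarith

theorem sincQ_zero : sincQ 0 = 0 := by
  rw [sincQ, dslope_same]
  have h := (contDiff_sinc.differentiable (by simp) 0).hasDerivAt
  have h1 : HasDerivAt (fun x : ℝ => 2 * x) 2 0 := by
    simpa using (hasDerivAt_id (0 : ℝ)).const_mul 2
  have h3 : HasDerivAt sinc (deriv sinc 0) (2 * 0) := by simpa using h
  have h4 : HasDerivAt (fun L => -(1 / 2) * sinc (2 * L)) (-(1 / 2) * (deriv sinc 0 * 2)) 0 :=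
    (h3.comp 0 h1).const_mul (-(1 / 2))
  rw [h4.deriv, deriv_sinc_zero]
  simp

end Sinc

section ExpFar

open Real

variable {f : ℝ → ℝ}

/-- The exponential map at `(X, θ)` in the region `|x| ≥ 1`, with `L = v_θ / X²`. -/
def farExp (X θ a L : ℝ) : Coord :=
  ![X * cos L + a * sinc L,
    θ + (X ^ 2 * L * (1 + cos L * sinc L) * (1 / 2) + X * a * L * sinc L ^ 2 + a ^ 2 * sincQ L)]

theorem farGeod_eq_farExp (X θ a t : ℝ) {L : ℝ} (hL : L ≠ 0) :
    farGeod X θ a L t = farExp X θ (a * t) (L * t) := by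
  rcases eq_or_ne t 0 with rfl | ht
  · simp [farGeod, farExp]
  · have h := mul_ne_zero hL ht
    ext i
    fin_cases i
    · simp [farGeod, farExp, sinc_of_ne_zero h]
      field_simp
    · simp [farGeod, farExp, sinc_of_ne_zero h, sincQ_of_ne_zero h]
      field_simp
      ring

/-- As long as the explicit curve stays in the region `|x| ≥ 1`, it is a geodesic. -/
theorem isExp_farExp (hf : IsProfile f) {y v : Coord} (hX : y 0 ≠ 0)
    (h : ∀ t ∈ Icc (0 : ℝ) 1, 1 ≤ |farExp (y 0) (y 1) (v 0 * t) (v 1 / y 0 ^ 2 * t) 0|) :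
    IsExp f (cov y) v (cov (farExp (y 0) (y 1) (v 0) (v 1 / y 0 ^ 2))) := by
  rcases eq_or_ne (v 1) 0 with hv | hv
  · refine ⟨fun t => farExp (y 0) (y 1) (v 0 * t) (v 1 / y 0 ^ 2 * t), fun _ => v, ?_, ?_, rfl, ?_⟩
    · intro t ht
      constructor
      · rw [hasDerivWithinAt_pi]
        intro i
        have h1 : HasDerivWithinAt (fun t : ℝ => y 0 + v 0 * t) (v 0) (Icc 0 1) t := by
          simpa using ((hasDerivAt_id t).const_mul (v 0)).const_add (y 0) |>.hasDerivWithinAt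
        fin_cases i
        · simpa [farExp, hv] using h1
        · simp [farExp, hv, sincQ_zero, hasDerivWithinAt_const]
      · have h2 : HasDerivWithinAt (fun _ : ℝ => v) 0 (Icc 0 1) t := hasDerivWithinAt_const ..
        refine h2.congr_deriv ?_
        show 0 = acc f _ v
        rw [acc_far hf (h t ht)]
        ext i
        fin_cases i <;> simp [hv]
    · congr 1
      ext i
      fin_cases i <;> simp [farExp, sincQ_zero]
    · simp
  · have hL : v 1 / y 0 ^ 2 ≠ 0 := by positivity
    set L := v 1 / y 0 ^ 2 with hLdef
    refine ⟨farGeod (y 0) (y 1) (v 0) L, farVel (y 0) (v 0) L, ?_, ?_, ?_, ?_⟩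
    · intro t ht
      refine ⟨(hasDerivAt_farGeod _ _ _ _ hL).hasDerivWithinAt,
        (hasDerivAt_farVel hf _ (y 1) _ hL ?_).hasDerivWithinAt⟩
      rw [farGeod_eq_farExp _ _ _ _ hL]
      exact h t ht
    · congr 1
      ext i
      fin_cases i <;> simp [farGeod]
    · ext i
      fin_cases i
      · simp [farVel]
      · simp [farVel, hLdef]
        field_simp
    · rw [farGeod_eq_farExp _ _ _ _ hL]
      simp

end ExpFar

/-! ### Injectivity radius -/

section InjectivityRadius

open Real

variable {f : ℝ → ℝ}

theorem mul_sinc (x : ℝ) : x * sinc x = sin x := by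
  rcases eq_or_ne x 0 with rfl | h
  · simp
  · rw [sinc_of_ne_zero h]
    field_simp

/-- The circle `x = X` is so short that two mirror-symmetric geodesics of length at most
`3.2 / |X|`, starting at a point in opposite horizontal directions, meet half-way around. -/
theorem exists_half_turn {X : ℝ} (hX : 5 ≤ |X|) :
    ∃ τ : ℝ, 0 < τ ∧ τ ≤ 16 / 5 / X ^ 2 ∧ X ^ 2 * (τ + sin τ * cos τ) / 2 = π := by
  have hX2 : 25 ≤ X ^ 2 := by nlinarith [sq_abs X]
  have hpos : 0 < X ^ 2 := by linarith
  set T := 16 / 5 / X ^ 2 with hT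
  have hT0 : 0 < T := by positivity
  have hXT : X ^ 2 * T = 16 / 5 := mul_div_cancel₀ _ hpos.ne'
  have hT1 : T ≤ 16 / 125 := by nlinarith
  have hcont : Continuous fun τ : ℝ => X ^ 2 * (τ + sin τ * cos τ) / 2 := by fun_prop
  -- up to a third-order error the right-hand side is `X² T = 16/5`, which exceeds `π`
  have hend : π ≤ X ^ 2 * (T + sin T * cos T) / 2 := by
    have h1 : 2 * T - (2 * T) ^ 3 / 6 < sin (2 * T) := sin_gt_sub_cube (by linarith)
    rw [sin_two_mul] at h1
    have h2 := pi_lt_d2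
    have h3 : X ^ 2 * T ^ 3 ≤ 16 / 5 * (16 / 125) ^ 2 := by
      calc X ^ 2 * T ^ 3 = (X ^ 2 * T) * T ^ 2 := by ring
        _ ≤ _ := by rw [hXT]; gcongr
    nlinarith
  obtain ⟨τ, ⟨h0, h1⟩, h2⟩ := intermediate_value_Icc hT0.le hcont.continuousOn
    (show π ∈ Icc _ _ from ⟨by simpa using pi_pos.le, hend⟩)
  refine ⟨τ, lt_of_le_of_ne h0 ?_, h1, h2⟩
  rintro rfl
  simp at h2
  exact pi_pos.ne h2

theorem injRad_le (hf : IsProfile f) {y : Coord} (hX : 5 ≤ |y 0|) :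
    injRad f (cov y) ≤ ENNReal.ofReal (16 / 5 / |y 0|) := by
  set X := y 0 with hXdef
  have hX2 : 25 ≤ X ^ 2 := by nlinarith [sq_abs X]
  have hX0 : X ≠ 0 := ne_zero_of_one_le_abs (by linarith)
  have hXpos : 0 < |X| := abs_pos.2 hX0
  obtain ⟨τ, hτ0, hτ1, hτ⟩ := exists_half_turn hX
  have hτs : τ ≤ 16 / 125 := hτ1.trans (by
    rw [div_le_iff₀ (by positivity)]; linarith)
  -- the geodesics with initial velocity `(0, ± τ X²)`
  have hgeo : ∀ σ : ℝ, |σ| = τ → IsExp f (cov y) ![0, σ * X ^ 2]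
      (cov ![X * cos σ, y 1 + X ^ 2 * (σ + sin σ * cos σ) / 2]) := by
    intro σ hσ
    have h := isExp_farExp hf (y := y) (v := ![0, σ * X ^ 2]) hX0 (by
      intro t ht
      have hlt : |σ * t| ≤ 16 / 125 := by
        rw [abs_mul, hσ, abs_of_nonneg ht.1]
        nlinarith [ht.2]
      have hcos := one_sub_sq_div_two_le_cos (x := σ * t)
      have hsq : (σ * t) ^ 2 ≤ (16 / 125) ^ 2 := sq_le_sq' (abs_le.1 hlt).1 (abs_le.1 hlt).2
      have hc : (1 / 2 : ℝ) ≤ cos (σ * t) := by nlinarith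
      have hval : farExp (y 0) (y 1) ((![0, σ * X ^ 2] : Coord) 0 * t)
          ((![0, σ * X ^ 2] : Coord) 1 / y 0 ^ 2 * t) 0 = X * cos (σ * t) := by
        simp [farExp, ← hXdef]
        left
        field_simp
      rw [hval, abs_mul, abs_of_pos (by linarith : 0 < cos (σ * t))]
      nlinarith)
    convert h using 2
    have hdiv : (![0, σ * X ^ 2] : Coord) 1 / y 0 ^ 2 = σ := by
      simp [← hXdef]
      field_simp
    rw [hdiv]
    ext i
    fin_cases i
    · simp [farExp, ← hXdef]
    · simp [farExp, ← hXdef]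
      rw [← mul_sinc]
      ring
  refine iSup₂_le fun r hr => ?_
  rw [ENNReal.le_ofReal_iff_toReal_le ENNReal.coe_ne_top (by positivity), ENNReal.coe_toReal]
  by_contra! hlt
  -- both initial velocities have length `τ |X| ≤ 16 / (5 |X|)`
  have hv : ∀ σ : ℝ, |σ| = τ → ![0, σ * X ^ 2] ∈ tball f (cov y) r := by
    intro σ hσ
    refine lt_of_le_of_lt ?_ hlt
    rw [vnorm_eq, (hf.deriv_far (x := y 0) (by linarith)).1, ← hXdef]
    refine Real.sqrt_le_iff.2 ⟨by positivity, ?_⟩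
    have h1 : σ ^ 2 ≤ (16 / 5 / X ^ 2) ^ 2 := by
      rw [← sq_abs, hσ]
      gcongr
    simp
    rw [div_pow (16 / 5 : ℝ), sq_abs]
    calc (X ^ 2)⁻¹ * (σ * X ^ 2) ^ 2 = X ^ 2 * σ ^ 2 := by field_simp
      _ ≤ X ^ 2 * (16 / 5 / X ^ 2) ^ 2 := by gcongr
      _ = _ := by field_simp
  have hp := abs_of_pos hτ0
  have hm : |-τ| = τ := by rw [abs_neg, hp]
  have heq : expMap f (cov y) ![0, τ * X ^ 2] = expMap f (cov y) ![0, -τ * X ^ 2] := by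
    rw [expMap_eq hf (hgeo τ hp), expMap_eq hf (hgeo (-τ) hm), cov_eq_iff]
    refine ⟨by simp, -1, ?_⟩
    simp only [Matrix.cons_val_one, Matrix.cons_val_fin_one, sin_neg, cos_neg]
    push_cast
    linarith
  have := congrFun (hr.2.1 (hv τ hp) (hv (-τ) hm) heq) 1
  have h : τ * X ^ 2 = -τ * X ^ 2 := this
  have h1 : 0 < τ * X ^ 2 := by positivity
  linarith

theorem tendsto_injRad (hf : IsProfile f) :
    Tendsto (injRad f) (comap (fun p : M => |p.2|) atTop) (𝓝 0) := by
  have h1 : Tendsto (fun t : ℝ => ENNReal.ofReal (16 / 5 / t)) atTop (𝓝 0) := by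
    have := ENNReal.tendsto_ofReal (tendsto_const_nhds (x := (16 / 5 : ℝ)).div_atTop tendsto_id)
    simpa using this
  have h2 := h1.comp (tendsto_comap (f := fun p : M => |p.2|) (x := atTop))
  refine tendsto_of_tendsto_of_tendsto_of_le_of_le' tendsto_const_nhds h2
    (Eventually.of_forall fun _ => zero_le) ?_
  filter_upwards [preimage_mem_comap (Ici_mem_atTop (5 : ℝ))] with p hp
  obtain ⟨y, rfl⟩ := exists_cov p
  exact injRad_le hf hp

theorem half_le_farExp {x a L : ℝ} (θ : ℝ) (hx : 5 / 2 ≤ x) (ha : |a| ≤ 7 / 10)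
    (hL : |L| ≤ 3 / 10) : x / 2 ≤ farExp x θ a L 0 := by
  have hcos := one_sub_sq_div_two_le_cos (x := L)
  have hsq : L ^ 2 ≤ (3 / 10) ^ 2 := sq_le_sq' (abs_le.1 hL).1 (abs_le.1 hL).2
  have h1 : |a * sinc L| ≤ 7 / 10 := by
    rw [abs_mul]
    exact (mul_le_mul ha (abs_sinc_le_one L) (abs_nonneg _) (by norm_num)).trans (by norm_num)
  have h2 := (abs_le.1 h1).1
  simp [farExp]
  nlinarith

/-- Short geodesics starting in the region `x ≥ 5/2` are the explicit ones. -/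
theorem isExp_of_small (hf : IsProfile f) {y v : Coord} (hx : 5 / 2 ≤ y 0) (ha : |v 0| ≤ 7 / 10)
    (hL : |v 1 / y 0 ^ 2| ≤ 3 / 10) :
    IsExp f (cov y) v (cov (farExp (y 0) (y 1) (v 0) (v 1 / y 0 ^ 2))) := by
  refine isExp_farExp hf (by linarith) fun t ht => ?_
  have ht' : |t| ≤ 1 := abs_le.2 ⟨by linarith [ht.1], ht.2⟩
  have key : ∀ {s B : ℝ}, |s| ≤ B → |s * t| ≤ B := by
    intro s B h
    rw [abs_mul]
    exact (mul_le_of_le_one_right (abs_nonneg s) ht').trans h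
  have := half_le_farExp (y 1) hx (key ha) (key hL)
  rw [le_abs]
  left
  linarith

theorem contDiff_farExp {n : ℕ∞} {V : Type*} [NormedAddCommGroup V] [NormedSpace ℝ V]
    {X θ a L : V → ℝ} (hX : ContDiff ℝ n X) (hθ : ContDiff ℝ n θ) (ha : ContDiff ℝ n a)
    (hL : ContDiff ℝ n L) : ContDiff ℝ n fun v => farExp (X v) (θ v) (a v) (L v) := by
  have h1 : ContDiff ℝ n fun v => sinc (L v) :=
    (contDiff_sinc.of_le (by exact_mod_cast le_top)).comp hL
  have h2 : ContDiff ℝ n fun v => sincQ (L v) :=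
    (contDiff_sincQ.of_le (by exact_mod_cast le_top)).comp hL
  refine contDiff_pi.2 fun i => ?_
  fin_cases i
  · simp only [farExp, Fin.zero_eta, Matrix.cons_val_zero]
    fun_prop
  · simp only [farExp, Fin.mk_one, Matrix.cons_val_one, Matrix.cons_val_fin_one]
    fun_prop

theorem hasFDerivAt_farExp_zero (θ : ℝ) {X : ℝ} (hX : X ≠ 0) :
    HasFDerivAt (fun v : Coord => farExp X θ (v 0) (v 1 / X ^ 2))
      (ContinuousLinearMap.id ℝ Coord) 0 := by
  have h0 : HasFDerivAt (fun v : Coord => v 0)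
      (ContinuousLinearMap.proj (R := ℝ) (φ := fun _ : Fin 2 => ℝ) 0) 0 :=
    (ContinuousLinearMap.proj (R := ℝ) (φ := fun _ : Fin 2 => ℝ) 0).hasFDerivAt
  have h1 : HasFDerivAt (fun v : Coord => v 1 / X ^ 2)
      ((X ^ 2)⁻¹ • (ContinuousLinearMap.proj (R := ℝ) (φ := fun _ : Fin 2 => ℝ) 1)) 0 := by
    have := (ContinuousLinearMap.proj (R := ℝ) (φ := fun _ : Fin 2 => ℝ) 1).hasFDerivAt
      (x := (0 : Coord)) |>.const_mul (X ^ 2)⁻¹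
    simp only [div_eq_inv_mul]
    exact this
  have hs : HasFDerivAt (fun v : Coord => sinc (v 1 / X ^ 2)) _ 0 :=
    (contDiff_sinc.differentiable (by simp) _).hasDerivAt.comp_hasFDerivAt (0 : Coord) h1
  have hq : HasFDerivAt (fun v : Coord => sincQ (v 1 / X ^ 2)) _ 0 :=
    (contDiff_sincQ.differentiable (by simp) _).hasDerivAt.comp_hasFDerivAt (0 : Coord) h1
  rw [hasFDerivAt_pi']
  intro i
  fin_cases i
  · refine ((h1.cos.const_mul X).add (h0.mul hs)).congr_fderiv ?_
    ext v
    simp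
  · refine (((((((h1.const_mul (X ^ 2)).mul ((h1.cos.mul hs).const_add 1)).mul_const (1 / 2)).add
      (((h0.const_mul X).mul h1).mul (hs.pow 2))).add ((h0.pow 2).mul hq))).const_add
        θ).congr_fderiv ?_
    ext v
    simp
    field_simp
    norm_num [sincQ_zero]

theorem injRad_pos (hf : IsProfile f) {y : Coord} (hX : 5 ≤ y 0) : 0 < injRad f (cov y) := by
  set X := y 0 with hXdef
  have hX0 : 0 < X := by linarith
  set E : Coord → Coord := fun v => farExp X (y 1) (v 0) (v 1 / X ^ 2) with hE
  have hsm : ContDiff ℝ ∞ E := contDiff_farExp contDiff_const contDiff_const (by fun_prop)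
    (by fun_prop)
  have hstrict : HasStrictFDerivAt E
      ((ContinuousLinearEquiv.refl ℝ Coord : Coord ≃L[ℝ] Coord) : Coord →L[ℝ] Coord) 0 :=
    hsm.contDiffAt.hasStrictFDerivAt' (hasFDerivAt_farExp_zero (y 1) hX0.ne') (by simp)
  have e1 : ∀ᶠ v in 𝓝 (0 : Coord), v ∈ (hstrict.toOpenPartialHomeomorph E).source :=
    (hstrict.toOpenPartialHomeomorph E).open_source.mem_nhds
      hstrict.mem_toOpenPartialHomeomorph_source
  have e2 : ∀ᶠ v in 𝓝 (0 : Coord),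
      fderiv ℝ E v ∈ range ((↑) : (Coord ≃L[ℝ] Coord) → (Coord →L[ℝ] Coord)) := by
    have hc : ContinuousAt (fderiv ℝ E) 0 := (hsm.continuous_fderiv (by simp)).continuousAt
    refine hc.eventually_mem ?_
    rw [hstrict.hasFDerivAt.fderiv]
    exact ContinuousLinearEquiv.nhds _
  have e3 : ∀ᶠ v in 𝓝 (0 : Coord), |E v 1 - E 0 1| < 1 := by
    have hc : Continuous fun v => |E v 1 - E 0 1| := by
      have := hsm.continuous
      fun_prop
    exact (hc.tendsto 0).eventually_lt_const (by simp)
  have e4 : ∀ᶠ v in 𝓝 (0 : Coord), |v 0| < 7 / 10 := by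
    have hc : Continuous fun v : Coord => |v 0| := by fun_prop
    exact (hc.tendsto 0).eventually_lt_const (by norm_num)
  have e5 : ∀ᶠ v in 𝓝 (0 : Coord), |v 1 / X ^ 2| < 3 / 10 := by
    have hc : Continuous fun v : Coord => |v 1 / X ^ 2| := by fun_prop
    exact (hc.tendsto 0).eventually_lt_const (by norm_num)
  obtain ⟨ρ, hρ, hball⟩ := Metric.eventually_nhds_iff_ball.1 (e1.and (e2.and (e3.and (e4.and e5))))
  have hsub : tball f (cov y) (ρ / X) ⊆ Metric.ball 0 ρ := by
    intro v hv
    have hv' : vnorm f (cov y) v < ρ / X := hv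
    have h0 := (abs_x_le_vnorm hf y v).trans_lt hv'
    have h1 : |X⁻¹ * v 1| ≤ vnorm f (cov y) v := abs_θ_le_vnorm (by
      rw [(hf.deriv_far (x := y 0) (by rw [← hXdef, abs_of_pos hX0]; linarith)).1, inv_pow])
    replace h1 := h1.trans_lt hv'
    rw [abs_mul, abs_of_pos (by positivity : 0 < X⁻¹), inv_mul_eq_div,
      div_lt_div_iff_of_pos_right hX0] at h1
    rw [mem_ball_zero_iff, pi_norm_lt_iff hρ]
    intro i
    fin_cases i
    · exact h0.trans_le (div_le_self hρ.le (by linarith))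
    · exact h1
  have hexp : ∀ v ∈ tball f (cov y) (ρ / X), IsExp f (cov y) v (cov (E v)) := by
    intro v hv
    obtain ⟨-, -, -, h4, h5⟩ := hball v (hsub hv)
    exact isExp_of_small hf (by linarith) h4.le h5.le
  obtain ⟨r, hr⟩ : ∃ r : ℝ≥0, (r : ℝ) = ρ / X := ⟨⟨ρ / X, by positivity⟩, rfl⟩
  have hD : ExpDiffeoOn f (cov y) r := by
    rw [hr]
    refine ⟨fun v hv => ⟨_, hexp v hv⟩, fun v hv w hw hvw => ?_, E, hsm.contDiffOn, fun v hv => ?_⟩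
    · rw [expMap_eq hf (hexp v hv), expMap_eq hf (hexp w hw), cov_eq_iff] at hvw
      obtain ⟨hx, n, hn⟩ := hvw
      have hn0 : n = 0 := by
        have hv1 := abs_lt.1 (hball v (hsub hv)).2.2.1
        have hw1 := abs_lt.1 (hball w (hsub hw)).2.2.1
        have hpi := pi_gt_three
        have hlt : |(n : ℝ)| < 1 := by
          rw [abs_lt]
          constructor <;> nlinarith
        exact Int.abs_lt_one_iff.1 (by exact_mod_cast hlt)
      have hθ : E v 1 = E w 1 := by
        rw [hn0] at hn
        simp at hn
        linarith
      refine (hstrict.toOpenPartialHomeomorph E).injOn (hball v (hsub hv)).1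
        (hball w (hsub hw)).1 ?_
      show E v = E w
      ext i
      fin_cases i
      · exact hx
      · exact hθ
    · refine ⟨(expMap_eq hf (hexp v hv)).symm, ?_⟩
      obtain ⟨e, he⟩ := (hball v (hsub hv)).2.1
      rw [← he]
      exact e.bijective
  have hle : (r : ℝ≥0∞) ≤ injRad f (cov y) :=
    le_iSup₂ (f := fun (r : ℝ≥0) (_ : ExpDiffeoOn f (cov y) r) => (r : ℝ≥0∞)) _ hD
  refine lt_of_lt_of_le ?_ hle
  rw [ENNReal.coe_pos, ← NNReal.coe_pos, hr]
  exact div_pos hρ hX0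

end InjectivityRadius

/-! ### Parametric integrals and covariant derivatives along geodesics -/

section ParametricIntegral

theorem integrable_weight_smul {V E : Type*} [TopologicalSpace V] [MeasurableSpace V]
    [OpensMeasurableSpace V] {μ : Measure V} [IsFiniteMeasureOnCompacts μ]
    [NormedAddCommGroup E] [NormedSpace ℝ E] {w : V → ℝ}
    (hw : Continuous w) (hwc : HasCompactSupport w) {g : V → E} (hg : Continuous g) :
    Integrable (fun z => w z • g z) μ :=
  (hw.smul hg).integrable_of_hasCompactSupport hwc.smul_right

variable {V : Type} [NormedAddCommGroup V] [NormedSpace ℝ V] [MeasurableSpace V] [BorelSpace V]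
  {μ : Measure V} [IsFiniteMeasureOnCompacts μ]

theorem hasFDerivAt_integral_weight {P E : Type} [NormedAddCommGroup P] [NormedSpace ℝ P]
    [FiniteDimensional ℝ P] [NormedAddCommGroup E] [NormedSpace ℝ E] {w : V → ℝ}
    (hw : Continuous w) (hwc : HasCompactSupport w) {F : P × V → E} (hF : ContDiff ℝ 1 F) (p : P) :
    HasFDerivAt (fun p => ∫ z, w z • F (p, z) ∂μ)
      (∫ z, w z • (fderiv ℝ F (p, z)).comp (ContinuousLinearMap.inl ℝ P V) ∂μ) p := by
  have : ProperSpace P := FiniteDimensional.proper_real P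
  have hcF := hF.continuous
  have hcF' : Continuous fun q : P × V =>
      (fderiv ℝ F q).comp (ContinuousLinearMap.inl ℝ P V) :=
    (hF.continuous_fderiv one_ne_zero).clm_comp continuous_const
  obtain ⟨C, hC⟩ := ((isCompact_closedBall p 1).prod hwc.isCompact).exists_bound_of_continuousOn
    hcF'.continuousOn
  have hint : ∀ q : P, Continuous fun z : V => ((q, z) : P × V) := fun q => by fun_prop
  refine hasFDerivAt_integral_of_dominated_of_fderiv_le (bound := fun z => |w z| * C)
    (F' := fun q z => w z • (fderiv ℝ F (q, z)).comp (ContinuousLinearMap.inl ℝ P V))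
    (Metric.closedBall_mem_nhds p one_pos) ?_ ?_ ?_ ?_ ?_ ?_
  · exact Eventually.of_forall fun q =>
      (integrable_weight_smul hw hwc (hcF.comp (hint q))).aestronglyMeasurable
  · exact integrable_weight_smul hw hwc (hcF.comp (hint p))
  · exact (integrable_weight_smul hw hwc (hcF'.comp (hint p))).aestronglyMeasurable
  · refine Eventually.of_forall fun z q hq => ?_
    rw [norm_smul, Real.norm_eq_abs]
    by_cases hz : z ∈ tsupport w
    · exact mul_le_mul_of_nonneg_left (hC (q, z) ⟨hq, hz⟩) (abs_nonneg _)
    · simp [image_eq_zero_of_notMem_tsupport hz]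
  · exact (hw.abs.mul continuous_const).integrable_of_hasCompactSupport
      (hwc.abs.mul_right)
  · refine Eventually.of_forall fun z q _ => ?_
    have h1 : HasFDerivAt (fun q : P => ((q, z) : P × V)) (ContinuousLinearMap.inl ℝ P V) q :=
      hasFDerivAt_prodMk_left q z
    exact ((hF.differentiable one_ne_zero (q, z)).hasFDerivAt.comp q h1).const_smul (w z)

/-- Smooth dependence on a parameter of an integral against a compactly supported weight. -/
theorem contDiff_integral_weight {P : Type} [NormedAddCommGroup P] [NormedSpace ℝ P]
    [FiniteDimensional ℝ P] {w : V → ℝ} (hw : Continuous w) (hwc : HasCompactSupport w) (n : ℕ) :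
    ∀ {E : Type} [NormedAddCommGroup E] [NormedSpace ℝ E] {F : P × V → E}, ContDiff ℝ ∞ F →
      ContDiff ℝ n (fun p => ∫ z, w z • F (p, z) ∂μ) := by
  induction n with
  | zero =>
    intro E _ _ F hF
    refine contDiff_zero.2 (continuous_iff_continuousAt.2 fun p => ?_)
    exact (hasFDerivAt_integral_weight hw hwc (hF.of_le (by simp)) p).continuousAt
  | succ n ih =>
    intro E _ _ F hF
    have h := hasFDerivAt_integral_weight (μ := μ) hw hwc (hF.of_le (by simp) : ContDiff ℝ 1 F)
    rw [Nat.cast_add, Nat.cast_one, contDiff_succ_iff_fderiv]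
    refine ⟨fun p => (h p).differentiableAt, by simp, ?_⟩
    rw [show fderiv ℝ (fun p => ∫ z, w z • F (p, z) ∂μ) = _ from funext fun p => (h p).fderiv]
    refine ih (F := fun q => (fderiv ℝ F q).comp (ContinuousLinearMap.inl ℝ P V)) ?_
    exact (hF.fderiv_right (m := ∞) (by simp)).clm_comp contDiff_const

/-- The partial derivative with respect to the first, real, variable. -/
def dfst {V : Type} [NormedAddCommGroup V] [NormedSpace ℝ V] (F : ℝ × V → ℝ) (p : ℝ × V) : ℝ :=
  fderiv ℝ F p (1, 0)

theorem contDiff_dfst {V : Type} [NormedAddCommGroup V] [NormedSpace ℝ V] {F : ℝ × V → ℝ}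
    (hF : ContDiff ℝ ∞ F) : ContDiff ℝ ∞ (dfst F) :=
  (hF.fderiv_right (m := ∞) (by simp)).clm_apply contDiff_const

theorem contDiff_iterate_dfst {V : Type} [NormedAddCommGroup V] [NormedSpace ℝ V] {F : ℝ × V → ℝ}
    (hF : ContDiff ℝ ∞ F) (k : ℕ) : ContDiff ℝ ∞ (dfst^[k] F) := by
  induction k with
  | zero => exact hF
  | succ k ih =>
    rw [Function.iterate_succ_apply']
    exact contDiff_dfst ih

theorem iteratedDeriv_eq_iterate_dfst {V : Type} [NormedAddCommGroup V] [NormedSpace ℝ V]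
    {F : ℝ × V → ℝ} (hF : ContDiff ℝ ∞ F) (k : ℕ) (z : V) :
    iteratedDeriv k (fun s => F (s, z)) = fun s => (dfst^[k] F) (s, z) := by
  induction k with
  | zero => simp
  | succ k ih =>
    rw [iteratedDeriv_succ, ih]
    funext s
    rw [Function.iterate_succ_apply']
    have h1 : HasDerivAt (fun s : ℝ => ((s, z) : ℝ × V)) (1, 0) s :=
      (hasDerivAt_id s).prodMk (hasDerivAt_const s z)
    have h2 := ((contDiff_iterate_dfst hF k).differentiable (by simp) (s, z)).hasFDerivAt
    exact (h2.comp_hasDerivAt s h1).deriv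

theorem iteratedDeriv_integral_weight {w : V → ℝ} (hw : Continuous w) (hwc : HasCompactSupport w)
    {F : ℝ × V → ℝ} (hF : ContDiff ℝ ∞ F) (k : ℕ) (s : ℝ) :
    iteratedDeriv k (fun s => ∫ z, w z * F (s, z) ∂μ) s =
      ∫ z, w z * iteratedDeriv k (fun s => F (s, z)) s ∂μ := by
  simp only [iteratedDeriv_eq_iterate_dfst hF]
  induction k generalizing s with
  | zero => simp
  | succ k ih =>
    rw [iteratedDeriv_succ, funext ih]
    have hk := contDiff_iterate_dfst hF k
    have h := (hasFDerivAt_integral_weight (μ := μ) hw hwc (hk.of_le (by simp)) s).hasDerivAt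
    have h2 := h.deriv
    simp only [smul_eq_mul] at h2
    rw [h2, ContinuousLinearMap.integral_apply]
    · simp only [Function.iterate_succ_apply']
      rfl
    · refine integrable_weight_smul hw hwc ?_
      have h3 := (hk.continuous_fderiv (by simp)).comp (Continuous.prodMk_right (Y := V) s)
      exact h3.clm_comp continuous_const

/-- Derivatives in the first variable depend continuously on a parameter `δ`, uniformly for the
other variable in a compact set. -/
theorem eventually_iteratedDeriv_close {V : Type} [NormedAddCommGroup V] [NormedSpace ℝ V]
    {Φ : ℝ × (ℝ × V) → ℝ} (hΦ : ContDiff ℝ ∞ Φ) (k : ℕ) {K : Set V} (hK : IsCompact K) {η : ℝ}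
    (hη : 0 < η) : ∀ᶠ δ in 𝓝 (0 : ℝ), ∀ z ∈ K,
      |iteratedDeriv k (fun s => Φ (s, (δ, z))) 0 - iteratedDeriv k (fun s => Φ (s, (0, z))) 0|
        < η := by
  simp only [iteratedDeriv_eq_iterate_dfst hΦ]
  have hc := (contDiff_iterate_dfst hΦ k).continuous
  refine hK.eventually_forall_of_forall_eventually fun z _ => ?_
  have h : Continuous fun q : ℝ × V =>
      |(dfst^[k] Φ) (0, (q.1, q.2)) - (dfst^[k] Φ) (0, (0, q.2))| := by fun_prop
  exact (h.tendsto (0, z)).eventually_lt_const (by simpa using hη)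

end ParametricIntegral

section CovariantDerivative

variable {f : ℝ → ℝ}

theorem contDiff_Gam (hf : IsProfile f) (k i j : Fin 2) : ContDiff ℝ ∞ (Gam f k i j) := by
  have c0 : ContDiff ℝ ∞ fun y : Coord => y 0 := by fun_prop
  have h1 : ContDiff ℝ ∞ fun y : Coord => deriv f (y 0) := hf.deriv_smooth.comp c0
  have h2 : ContDiff ℝ ∞ fun y : Coord => deriv f (y 0) / (2 * f (y 0)) :=
    (logDeriv_smooth hf).comp c0
  rw [Gam_eq hf]
  by_cases hk : k = 0
  · by_cases hij : i = 1 ∧ j = 1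
    · simp only [hk, hij, if_true, and_self]
      fun_prop
    · simp only [hk, hij, if_true, if_false]
      fun_prop
  · by_cases hij : i ≠ j
    · simp only [hk, if_false, if_pos hij]
      exact h2
    · simp only [hk, if_false, if_neg hij]
      fun_prop

theorem contDiffOn_pd {F : Coord → ℝ} {Ω : Set Coord} (hΩ : IsOpen Ω) (hF : ContDiffOn ℝ ∞ F Ω)
    (i : Fin 2) : ContDiffOn ℝ ∞ (pd i F) Ω :=
  (hF.fderiv_of_isOpen hΩ (m := ∞) (by simp)).clm_apply contDiffOn_const

theorem contDiffOn_covDeriv (hf : IsProfile f) {h : M → ℝ} {Ω : Set Coord} (hΩ : IsOpen Ω)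
    (hh : ContDiffOn ℝ ∞ (fun y => h (cov y)) Ω) (k : ℕ) (I : Fin k → Fin 2) :
    ContDiffOn ℝ ∞ (covDeriv f h k I) Ω := by
  induction k with
  | zero => exact hh
  | succ k ih =>
    refine (contDiffOn_pd hΩ (ih _) (I 0)).sub ?_
    refine ContDiffOn.sum fun s _ => ContDiffOn.sum fun m _ => ?_
    exact (contDiff_Gam hf _ _ _).contDiffOn.mul (ih _)

theorem fderiv_apply_eq_sum_pd (F : Coord → ℝ) (y v : Coord) :
    fderiv ℝ F y v = ∑ m, v m * pd m F y := by
  conv_lhs => rw [pi_eq_sum_univ' v]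
  rw [map_sum]
  refine Finset.sum_congr rfl fun m _ => ?_
  rw [map_smul, smul_eq_mul, pd]

/-- In `d/ds` of `∇ᵏh(γ', …, γ')` along a geodesic `γ`, the terms with `γ''` are the Christoffel
terms of `∇ᵏ⁺¹h(γ', …, γ')`. -/
theorem sum_acc_eq (f : ℝ → ℝ) (y w : Coord) {k : ℕ} (C : (Fin k → Fin 2) → ℝ) (s : Fin k) :
    ∑ I : Fin k → Fin 2, (∏ j ∈ Finset.univ.erase s, w (I j)) * acc f y w (I s) * C I =
      -∑ a, ∑ I : Fin k → Fin 2, w a * (∏ j, w (I j)) *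
        ∑ m, Gam f m a (I s) y * C (Function.update I s m) := by
  let T : (Fin k → Fin 2) × Fin 2 → ℝ := fun q =>
    ∑ p, (∏ j ∈ Finset.univ.erase s, w (q.1 j)) * Gam f (q.1 s) p q.2 y * w p * w q.2 * C q.1
  have hl : ∑ I : Fin k → Fin 2, (∏ j ∈ Finset.univ.erase s, w (I j)) * acc f y w (I s) * C I =
      -∑ q, T q := by
    rw [Fintype.sum_prod_type, ← Finset.sum_neg_distrib]
    refine Finset.sum_congr rfl fun I _ => ?_
    simp only [T, acc]
    rw [Finset.sum_comm]
    simp only [mul_neg, neg_mul, Finset.mul_sum, Finset.sum_mul, neg_inj]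
    exact Finset.sum_congr rfl fun p _ => Finset.sum_congr rfl fun q _ => by ring
  -- exchanging the index `I s` with the summation index `m` is an involution
  let σ : Equiv.Perm ((Fin k → Fin 2) × Fin 2) :=
    Function.Involutive.toPerm (fun q => (Function.update q.1 s q.2, q.1 s)) fun q => by simp
  rw [hl, ← Equiv.sum_comp σ T, Fintype.sum_prod_type, neg_inj, eq_comm, Finset.sum_comm]
  refine Finset.sum_congr rfl fun I _ => ?_
  simp only [Finset.mul_sum]
  rw [Finset.sum_comm]
  refine Finset.sum_congr rfl fun m _ => ?_
  show _ = ∑ p, (∏ j ∈ Finset.univ.erase s, w (Function.update I s m j)) *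
    Gam f (Function.update I s m s) p (I s) y * w p * w (I s) * C (Function.update I s m)
  refine Finset.sum_congr rfl fun p _ => ?_
  have hprod : ∏ j ∈ Finset.univ.erase s, w (Function.update I s m j) =
      ∏ j ∈ Finset.univ.erase s, w (I j) :=
    Finset.prod_congr rfl fun j hj => by rw [Function.update_of_ne (Finset.ne_of_mem_erase hj)]
  rw [hprod, Function.update_self, ← Finset.mul_prod_erase Finset.univ _ (Finset.mem_univ s)]
  ring

/-- Along a geodesic `γ`, `(d/ds)ᵏ h(γ(s)) = ∇ᵏh(γ', …, γ')`. -/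
theorem iteratedDeriv_along_geodesic (hf : IsProfile f) {h : M → ℝ} {Ω : Set Coord} (hΩ : IsOpen Ω)
    (hh : ContDiffOn ℝ ∞ (fun y => h (cov y)) Ω) {γ w : ℝ → Coord} {J : Set ℝ} (hJ : IsOpen J)
    (hγ : ∀ s ∈ J, HasDerivAt γ (w s) s) (hw : ∀ s ∈ J, HasDerivAt w (acc f (γ s) (w s)) s)
    (hin : ∀ s ∈ J, γ s ∈ Ω) (k : ℕ) : ∀ s ∈ J,
      iteratedDeriv k (fun s => h (cov (γ s))) s =
        ∑ I : Fin k → Fin 2, (∏ i, w s (I i)) * covDeriv f h k I (γ s) := by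
  induction k with
  | zero =>
    intro s _
    simp [covDeriv]
  | succ k ih =>
    intro s hs
    rw [iteratedDeriv_succ]
    have hev : iteratedDeriv k (fun s => h (cov (γ s))) =ᶠ[𝓝 s]
        fun s => ∑ I : Fin k → Fin 2, (∏ i, w s (I i)) * covDeriv f h k I (γ s) := by
      filter_upwards [hJ.mem_nhds hs] with t ht using ih t ht
    rw [hev.deriv_eq]
    have hC : ∀ I : Fin k → Fin 2, HasDerivAt (fun s => covDeriv f h k I (γ s))
        (∑ m, w s m * pd m (covDeriv f h k I) (γ s)) s := by
      intro I
      have hd : DifferentiableAt ℝ (covDeriv f h k I) (γ s) :=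
        ((contDiffOn_covDeriv hf hΩ hh k I).contDiffAt (hΩ.mem_nhds (hin s hs))).differentiableAt
          (by simp)
      rw [← fderiv_apply_eq_sum_pd]
      exact hd.hasFDerivAt.comp_hasDerivAt s (hγ s hs)
    have hP : ∀ I : Fin k → Fin 2, HasDerivAt (fun s => ∏ i, w s (I i))
        (∑ i, (∏ j ∈ Finset.univ.erase i, w s (I j)) * acc f (γ s) (w s) (I i)) s := fun I =>
      HasDerivAt.fun_finsetProd fun i _ => hasDerivAt_pi.1 (hw s hs) (I i)
    rw [(HasDerivAt.fun_sum fun I _ => (hP I).fun_mul (hC I)).deriv]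
    rw [← (Fin.consEquiv fun _ : Fin (k + 1) => Fin 2).sum_comp, Fintype.sum_prod_type]
    have htail : ∀ (a : Fin 2) (I : Fin k → Fin 2),
        Fin.tail ((Fin.consEquiv fun _ : Fin (k + 1) => Fin 2) (a, I)) = I := fun _ _ => rfl
    simp only [covDeriv, htail]
    simp only [Fin.consEquiv_apply, Fin.prod_univ_succ, Fin.cons_zero, Fin.cons_succ, mul_sub,
      Finset.sum_sub_distrib]
    rw [Finset.sum_add_distrib, add_comm, sub_eq_add_neg]
    congr 1
    · rw [Finset.sum_comm]
      refine Finset.sum_congr rfl fun I _ => ?_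
      rw [Finset.mul_sum]
      exact Finset.sum_congr rfl fun a _ => by ring
    · simp only [Finset.sum_mul]
      rw [Finset.sum_comm]
      simp only [sum_acc_eq]
      rw [Finset.sum_neg_distrib, neg_inj, Finset.sum_comm]
      refine Finset.sum_congr rfl fun a _ => ?_
      rw [Finset.sum_comm]
      refine Finset.sum_congr rfl fun I _ => ?_
      rw [Finset.mul_sum]

/-- The purely horizontal component of `∇ᵏh` bounds the norm from below. -/
theorem le_covDerivNorm (hf : IsProfile f) (h : M → ℝ) (k : ℕ) {y : Coord} (hy : 1 ≤ |y 0|) :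
    |y 0| ^ k * |covDeriv f h k (fun _ => 1) y| ≤ covDerivNorm f h k y := by
  have h0 := (hf.deriv_far hy).1
  refine Real.le_sqrt_of_sq_le ?_
  have hdiag : ∀ I : Fin k → Fin 2, ∑ J : Fin k → Fin 2,
      (∏ s, gUp f (I s) (J s) y) * covDeriv f h k I y * covDeriv f h k J y =
        (∏ s, gUp f (I s) (I s) y) * covDeriv f h k I y ^ 2 := by
    intro I
    rw [Finset.sum_eq_single I]
    · ring
    · intro J _ hJ
      obtain ⟨s, hs⟩ := Function.ne_iff.1 hJ
      rw [Finset.prod_eq_zero (Finset.mem_univ s), zero_mul, zero_mul]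
      rw [gUp_eq hf, if_neg (Ne.symm hs)]
    · simp
  simp only [hdiag]
  have hpos : ∀ I : Fin k → Fin 2, 0 ≤ (∏ s, gUp f (I s) (I s) y) * covDeriv f h k I y ^ 2 := by
    intro I
    refine mul_nonneg (Finset.prod_nonneg fun s _ => ?_) (sq_nonneg _)
    rw [gUp_eq hf]
    have := (hf.pos (y 0)).le
    split_ifs <;> positivity
  refine le_trans (le_of_eq ?_) (Finset.single_le_sum (fun I _ => hpos I)
    (Finset.mem_univ fun _ => (1 : Fin 2)))
  simp [gUp_eq hf, h0]
  rw [mul_pow, sq_abs, ← pow_mul, ← pow_mul, mul_comm k 2, pow_mul |y 0|, sq_abs, ← pow_mul]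

end CovariantDerivative

/-! ### Smoothings of the test functions in rescaled variables -/

section Weight

variable {ψ : ℝ → ℝ} {R : ℝ}

/-- The Euclidean length of a coordinate vector. -/
def elen (z : Coord) : ℝ := Real.sqrt (z 0 ^ 2 + z 1 ^ 2)

theorem continuous_elen : Continuous elen := by unfold elen; fun_prop

theorem abs_coord_le_elen (z : Coord) (i : Fin 2) : |z i| ≤ elen z := by
  refine Real.abs_le_sqrt ?_
  fin_cases i
  · have := sq_nonneg (z 1)
    simpa using this
  · have := sq_nonneg (z 0)
    simpa using this

/-- The probability density `R⁻² ψ(|z| / R)` on the plane. -/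
def weight (ψ : ℝ → ℝ) (R : ℝ) (z : Coord) : ℝ := (R ^ 2)⁻¹ * ψ (elen z / R)

theorem integral_diag {a b : ℝ} (ha : 0 < a) (hb : 0 < b) (g : Coord → ℝ) :
    ∫ v, g v = a * b * ∫ z : Coord, g ![a * z 0, b * z 1] := by
  let T : Coord →L[ℝ] Coord := LinearMap.toContinuousLinearMap
    (Matrix.toLin' (Matrix.diagonal ![a, b]))
  have hT : ∀ z, T z = ![a * z 0, b * z 1] := by
    intro z
    ext i
    fin_cases i <;> simp [T, Matrix.mulVec_diagonal]
  have hdet : T.det = a * b := by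
    simp [T, ContinuousLinearMap.det, LinearMap.det_toLin']
  have hinj : Function.Injective T := by
    intro z z' h
    rw [hT, hT] at h
    have h0 : a * z 0 = a * z' 0 := congrFun h 0
    have h1 : b * z 1 = b * z' 1 := congrFun h 1
    ext i
    fin_cases i
    · exact mul_left_cancel₀ ha.ne' h0
    · exact mul_left_cancel₀ hb.ne' h1
  have hsurj : Function.Surjective T := by
    intro z
    refine ⟨![a⁻¹ * z 0, b⁻¹ * z 1], ?_⟩
    rw [hT]
    ext i
    fin_cases i <;> simp [ha.ne', hb.ne']
  have h := integral_image_eq_integral_abs_det_fderiv_smul (volume : Measure Coord)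
    MeasurableSet.univ (f := T) (f' := fun _ => T) (fun x _ => T.hasFDerivAt.hasFDerivWithinAt)
    hinj.injOn g
  rw [image_univ, hsurj.range_eq, setIntegral_univ, setIntegral_univ] at h
  rw [h, hdet, abs_of_pos (by positivity), ← integral_const_mul]
  simp only [hT, smul_eq_mul]

theorem continuous_weight (hψ : IsKernel ψ) : Continuous (weight ψ R) := by
  have h1 := hψ.smooth.continuous
  have h2 := continuous_elen
  unfold weight
  fun_prop

theorem weight_nonneg (hψ : IsKernel ψ) (z : Coord) : 0 ≤ weight ψ R z :=
  mul_nonneg (by positivity) (hψ.nonneg _)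

theorem elen_le_of_weight_ne_zero (hψ : IsKernel ψ) (hR : 0 < R) {z : Coord}
    (h : weight ψ R z ≠ 0) : elen z ≤ R := by
  have h1 : ψ (elen z / R) ≠ 0 := right_ne_zero_of_mul h
  have h2 := (hψ.supp (subset_tsupport ψ h1)).2
  rwa [div_le_one hR] at h2

theorem hasCompactSupport_weight (hψ : IsKernel ψ) (hR : 0 < R) :
    HasCompactSupport (weight ψ R) := by
  refine HasCompactSupport.of_support_subset_isCompact (isCompact_closedBall (0 : Coord) R) ?_
  intro z hz
  rw [mem_closedBall_zero_iff, pi_norm_le_iff_of_nonneg hR.le]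
  exact fun i => (abs_coord_le_elen z i).trans (elen_le_of_weight_ne_zero hψ hR hz)

theorem integral_weight (hψ : IsKernel ψ) (hR : 0 < R) : ∫ z, weight ψ R z = 1 := by
  have h1 : ∫ z : Coord, ψ (elen z) = 1 := by
    rw [← hψ.mass, ← (PiLp.volume_preserving_toLp (Fin 2)).integral_comp
      (MeasurableEquiv.toLp 2 (Fin 2 → ℝ)).measurableEmbedding]
    refine integral_congr_ae (Eventually.of_forall fun z => ?_)
    simp [EuclideanSpace.norm_eq, elen, Fin.sum_univ_two]
  rw [integral_diag hR hR]
  have h2 : ∀ z : Coord, weight ψ R ![R * z 0, R * z 1] = (R ^ 2)⁻¹ * ψ (elen z) := by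
    intro z
    have h3 : elen ![R * z 0, R * z 1] = R * elen z := by
      rw [elen, elen, ← Real.sqrt_sq hR.le, ← Real.sqrt_mul (by positivity), Real.sqrt_sq hR.le]
      congr 1
      simp
      ring
    rw [weight, h3, mul_div_cancel_left₀ _ hR.ne']
  simp only [h2]
  rw [integral_const_mul, h1]
  field_simp

theorem integrable_weight_mul (hψ : IsKernel ψ) (hR : 0 < R) {g : Coord → ℝ} (hg : Continuous g) :
    Integrable fun z => weight ψ R z * g z := by
  simpa using integrable_weight_smul (μ := volume) (continuous_weight hψ)
    (hasCompactSupport_weight hψ hR) hg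

theorem integrable_weight (hψ : IsKernel ψ) (hR : 0 < R) : Integrable (weight ψ R) :=
  (continuous_weight hψ).integrable_of_hasCompactSupport (hasCompactSupport_weight hψ hR)

/-- By rotational symmetry both coordinates have the same second moment, which is therefore at most
`R² / 2`. -/
theorem integral_weight_sq_le (hψ : IsKernel ψ) (hR : 0 < R) :
    ∫ z : Coord, weight ψ R z * z 1 ^ 2 ≤ R ^ 2 / 2 := by
  have hswap : ∫ z : Coord, weight ψ R z * z 1 ^ 2 = ∫ z : Coord, weight ψ R z * z 0 ^ 2 := by
    have h := (volume_measurePreserving_piCongrLeft (fun _ : Fin 2 => ℝ)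
      (Equiv.swap (0 : Fin 2) 1)).integral_comp (MeasurableEquiv.measurableEmbedding _)
      (fun z : Coord => weight ψ R z * z 1 ^ 2)
    rw [← h]
    refine integral_congr_ae (Eventually.of_forall fun z => ?_)
    have e0 : (MeasurableEquiv.piCongrLeft (fun _ : Fin 2 => ℝ) (Equiv.swap (0 : Fin 2) 1)) z 0 =
        z 1 := rfl
    have e1 : (MeasurableEquiv.piCongrLeft (fun _ : Fin 2 => ℝ) (Equiv.swap (0 : Fin 2) 1)) z 1 =
        z 0 := rfl
    simp only [weight, elen, e0, e1]
    rw [add_comm (z 0 ^ 2)]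
  have h0 := integrable_weight_mul hψ hR (g := fun z => z 0 ^ 2) (by fun_prop)
  have h1 := integrable_weight_mul hψ hR (g := fun z => z 1 ^ 2) (by fun_prop)
  have hsum : (∫ z : Coord, weight ψ R z * z 0 ^ 2) + ∫ z : Coord, weight ψ R z * z 1 ^ 2 ≤
      R ^ 2 := by
    rw [← integral_add h0 h1]
    calc _ ≤ ∫ z : Coord, weight ψ R z * R ^ 2 := by
          refine integral_mono (h0.add h1) ((integrable_weight hψ hR).mul_const _) fun z => ?_
          show weight ψ R z * z 0 ^ 2 + weight ψ R z * z 1 ^ 2 ≤ weight ψ R z * R ^ 2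
          rw [← mul_add]
          by_cases hz : weight ψ R z = 0
          · simp [hz]
          · refine mul_le_mul_of_nonneg_left ?_ (weight_nonneg hψ z)
            exact (Real.sqrt_le_left hR.le).1 (elen_le_of_weight_ne_zero hψ hR hz)
      _ = R ^ 2 := by rw [integral_mul_const, integral_weight hψ hR, one_mul]
  linarith

/-- Averaging over a disc of radius at most `8/5` does not destroy a unit-frequency oscillation. -/
theorem le_integral_weight_cos (hψ : IsKernel ψ) (hR : 0 < R) (hR' : R ≤ 8 / 5) :
    9 / 25 ≤ ∫ z : Coord, weight ψ R z * Real.cos (z 1) := by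
  have h1 := integrable_weight_mul hψ hR (g := fun z => z 1 ^ 2) (by fun_prop)
  have hc := integrable_weight_mul hψ hR (g := fun z => Real.cos (z 1)) (by fun_prop)
  have h2 : ∫ z : Coord, (weight ψ R z - (1 / 2) * (weight ψ R z * z 1 ^ 2)) ≤
      ∫ z : Coord, weight ψ R z * Real.cos (z 1) := by
    refine integral_mono ((integrable_weight hψ hR).sub (h1.const_mul _)) hc fun z => ?_
    have h3 := mul_le_mul_of_nonneg_left (Real.one_sub_sq_div_two_le_cos (x := z 1))
      (weight_nonneg (R := R) hψ z)
    show weight ψ R z - 1 / 2 * (weight ψ R z * z 1 ^ 2) ≤ weight ψ R z * Real.cos (z 1)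
    linarith
  rw [integral_sub (integrable_weight hψ hR) (h1.const_mul _), integral_const_mul,
    integral_weight hψ hR] at h2
  have h4 := integral_weight_sq_le hψ hR
  have h5 : R ^ 2 ≤ (8 / 5) ^ 2 := by gcongr
  linarith

end Weight

section TestFunction

open Real

variable {f : ℝ → ℝ}

/-- The test functions `c f^(m/2) cos θ`: for `m = 1` a multiple of the length of the circle through
the point, times an oscillation; for `m = 0` the oscillation alone. -/
def testFn (f : ℝ → ℝ) (m : ℕ) (c : ℝ) (p : M) : ℝ :=
  c * sqrt (f p.2) ^ m * Real.cos_periodic.lift p.1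

theorem testFn_cov (f : ℝ → ℝ) (m : ℕ) (c : ℝ) (y : Coord) :
    testFn f m c (cov y) = c * sqrt (f (y 0)) ^ m * cos (y 1) := rfl

theorem continuous_testFn (hf : IsProfile f) (m : ℕ) (c : ℝ) : Continuous (testFn f m c) := by
  have h1 : Continuous (Real.cos_periodic.lift : AddCircle (2 * π) → ℝ) :=
    continuous_quot_lift _ continuous_cos
  have h2 := hf.smooth.continuous
  unfold testFn
  fun_prop

theorem sqrt_far (hf : IsProfile f) {x : ℝ} (hx : 1 ≤ |x|) : sqrt (f x) = |x|⁻¹ := by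
  rw [(hf.deriv_far hx).1, sqrt_inv, sqrt_sq_eq_abs]

theorem sqrt_far_le_one (hf : IsProfile f) {x : ℝ} (hx : 1 ≤ |x|) : sqrt (f x) ≤ 1 := by
  rw [sqrt_far hf hx]
  exact inv_le_one_of_one_le₀ hx

theorem testFn_bounded (hf : IsProfile f) (m : ℕ) (c : ℝ) : ∃ B : ℝ, ∀ p, |testFn f m c p| ≤ B := by
  have hc := hf.smooth.continuous
  obtain ⟨B, hB, h⟩ := exists_bound_of_bound_far (g := fun x => sqrt (f x) ^ m) (by fun_prop)
    (B := 1) (by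
      intro x hx
      rw [abs_of_nonneg (by positivity)]
      exact pow_le_one₀ (sqrt_nonneg _) (sqrt_far_le_one hf hx))
  refine ⟨|c| * B, fun p => ?_⟩
  obtain ⟨y, rfl⟩ := exists_cov p
  rw [testFn_cov, abs_mul, abs_mul]
  have h1 := h (y 0)
  exact (mul_le_mul (mul_le_mul_of_nonneg_left h1 (abs_nonneg c)) (abs_cos_le_one _)
    (abs_nonneg _) (by positivity)).trans_eq (mul_one _)

/-- For `m = 1` and small `c` the test function is `1`-Lipschitz. -/
theorem exists_lipschitz_testFn (hf : IsProfile f) : ∃ c : ℝ, 0 < c ∧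
    ∀ p q, |testFn f 1 c p - testFn f 1 c q| ≤ rdist f p q := by
  have hφ : ∀ x, HasDerivAt (fun x => sqrt (f x)) (deriv f x / (2 * sqrt (f x))) x := fun x =>
    (hf.differentiable x).hasDerivAt.sqrt (hf.pos x).ne'
  have hφc : Continuous fun x => deriv f x / (2 * sqrt (f x)) := by
    refine hf.deriv_smooth.continuous.div ?_ fun x => ?_
    · have := hf.smooth.continuous
      fun_prop
    · have := sqrt_pos.2 (hf.pos x)
      positivity
  obtain ⟨B, hB0, hB⟩ := exists_bound_of_bound_far hφc (B := 1) (by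
    intro x hx
    have h0 := ne_zero_of_one_le_abs hx
    rw [(hf.deriv_far hx).2.1, sqrt_far hf hx, abs_div, abs_mul, abs_mul, abs_inv, abs_inv, abs_pow,
      abs_abs]
    have hpos : 0 < |x| := abs_pos.2 h0
    have h1 : 1 ≤ |x| ^ 2 := one_le_pow₀ hx
    have h2 : |(-2 : ℝ)| * (|x| ^ 3)⁻¹ / (|(2 : ℝ)| * |x|⁻¹) = (|x| ^ 2)⁻¹ := by
      rw [abs_neg, abs_two]
      field_simp
    rw [h2]
    exact inv_le_one_of_one_le₀ h1)
  refine ⟨(1 + B)⁻¹, by positivity, fun p q => ?_⟩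
  set c := (1 + B)⁻¹ with hc
  have hcB : c * (1 + B) = 1 := inv_mul_cancel₀ (by positivity)
  have hc0 : 0 < c := by positivity
  refine le_csInf (lengths_nonempty p q) ?_
  rintro L ⟨γ, hγ, rfl, rfl, rfl⟩
  rw [abs_sub_comm]
  have hd : ∀ t, HasDerivAt (fun t => testFn f 1 c (cov (γ t)))
      (c * (deriv f (γ t 0) / (2 * sqrt (f (γ t 0))) * deriv γ t 0 * cos (γ t 1)
        + sqrt (f (γ t 0)) * (-sin (γ t 1) * deriv γ t 1))) t := by
    intro t
    have h1 : HasDerivAt (fun t => sqrt (f (γ t 0))) _ t :=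
      HasDerivAt.comp (h₂ := fun x => sqrt (f x)) (h := fun s => γ s 0) t (hφ (γ t 0))
        (hasDerivAt_coord hγ t 0)
    have h2 := (hasDerivAt_coord hγ t 1).cos
    have h3 := (h1.fun_mul h2).const_mul c
    simp only [testFn_cov, pow_one, mul_assoc c]
    exact h3
  refine abs_sub_le_integral_vnorm hf hγ (g := fun t => testFn f 1 c (cov (γ t))) hd ?_
    zero_le_one fun t _ => ?_
  · have c1 := hγ.continuous
    have c2 := hγ.continuous_deriv le_rfl
    have c3 : Continuous fun t => deriv f (γ t 0) / (2 * sqrt (f (γ t 0))) :=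
      hφc.comp ((continuous_apply 0).comp c1)
    have c4 := hf.smooth.continuous
    fun_prop
  · rw [vnorm_eq]
    refine abs_le_sqrt ?_
    set b := deriv f (γ t 0) / (2 * sqrt (f (γ t 0))) with hb
    have hb2 : b ^ 2 ≤ B ^ 2 := sq_le_sq' (abs_le.1 (hB _)).1 (abs_le.1 (hB _)).2
    have hfs : f (γ t 0) * deriv γ t 1 ^ 2 = (sqrt (f (γ t 0)) * deriv γ t 1) ^ 2 := by
      rw [mul_pow, sq_sqrt (hf.pos _).le]
    rw [hfs]
    set p := deriv γ t 0
    set q := sqrt (f (γ t 0)) * deriv γ t 1 with hq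
    have he : sqrt (f (γ t 0)) * (-sin (γ t 1) * deriv γ t 1) = -sin (γ t 1) * q := by
      rw [hq]; ring
    rw [he]
    have hcs : (b * p * cos (γ t 1) + -sin (γ t 1) * q) ^ 2 ≤
        ((b * p) ^ 2 + q ^ 2) * (cos (γ t 1) ^ 2 + sin (γ t 1) ^ 2) := by
      nlinarith [sq_nonneg (b * p * sin (γ t 1) + q * cos (γ t 1))]
    rw [cos_sq_add_sin_sq, mul_one] at hcs
    have h1 : (b * p) ^ 2 + q ^ 2 ≤ (1 + B) ^ 2 * (p ^ 2 + q ^ 2) := by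
      nlinarith [mul_le_mul_of_nonneg_right hb2 (sq_nonneg p), sq_nonneg p, sq_nonneg q,
        mul_nonneg hB0.le (sq_nonneg p), mul_nonneg hB0.le (sq_nonneg q),
        mul_nonneg (sq_nonneg B) (sq_nonneg q)]
    calc (c * (b * p * cos (γ t 1) + -sin (γ t 1) * q)) ^ 2
        = c ^ 2 * (b * p * cos (γ t 1) + -sin (γ t 1) * q) ^ 2 := by ring
      _ ≤ c ^ 2 * ((1 + B) ^ 2 * (p ^ 2 + q ^ 2)) := by gcongr; exact hcs.trans h1
      _ = (c * (1 + B)) ^ 2 * (p ^ 2 + q ^ 2) := by ring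
      _ = p ^ 2 + q ^ 2 := by rw [hcB]; ring

end TestFunction

section Rescaling

open Real

/-- A positive smooth function on the line which is the identity on `[1/4, ∞)`. -/
def reg (x : ℝ) : ℝ := 1 / 8 + smoothTransition (8 * x - 1) * (x - 1 / 8)

theorem reg_pos (x : ℝ) : 0 < reg x := by
  rcases le_total x (1 / 8) with h | h
  · simp [reg, smoothTransition.zero_of_nonpos (by linarith : 8 * x - 1 ≤ 0)]
  · have h1 := smoothTransition.nonneg (8 * x - 1)
    have := mul_nonneg h1 (by linarith : 0 ≤ x - 1 / 8)
    rw [reg]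
    linarith

theorem reg_eq {x : ℝ} (h : 1 / 4 ≤ x) : reg x = x := by
  rw [reg, smoothTransition.one_of_one_le (by linarith)]
  ring

theorem contDiff_reg : ContDiff ℝ ∞ reg := by
  have h : ContDiff ℝ ∞ fun x : ℝ => smoothTransition (8 * x - 1) :=
    smoothTransition.contDiff.comp (by fun_prop)
  unfold reg
  fun_prop

/-- The value of the test function `x⁻ᵐ cos θ` at the exponential of a tangent vector, in rescaled
variables: with `δ = X⁻²`, the base point is `(X ξ, θ)`, the vector has components
`(z₀ / X, z₁ ξ)`, and the value is multiplied by `Xᵐ`. The function `reg` makes it smooth for all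
values of the arguments. -/
def amp (m : ℕ) (δ ξ θ : ℝ) (z : Coord) : ℝ :=
  (reg (reg ξ * cos (δ * z 1 / reg ξ) + δ * z 0 * sinc (δ * z 1 / reg ξ)))⁻¹ ^ m *
    cos (θ + (reg ξ * z 1 * (1 + cos (δ * z 1 / reg ξ) * sinc (δ * z 1 / reg ξ)) * (1 / 2)
      + reg ξ * z 0 * (δ * z 1 / reg ξ) * sinc (δ * z 1 / reg ξ) ^ 2
      + δ * z 0 ^ 2 * sincQ (δ * z 1 / reg ξ)))

theorem contDiff_amp (m : ℕ) {V : Type*} [NormedAddCommGroup V] [NormedSpace ℝ V]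
    {δ ξ θ : V → ℝ} {z : V → Coord} (hδ : ContDiff ℝ ∞ δ) (hξ : ContDiff ℝ ∞ ξ)
    (hθ : ContDiff ℝ ∞ θ) (hz : ContDiff ℝ ∞ z) :
    ContDiff ℝ ∞ fun v => amp m (δ v) (ξ v) (θ v) (z v) := by
  have h0 : ContDiff ℝ ∞ fun v => z v 0 := by fun_prop
  have h1 : ContDiff ℝ ∞ fun v => z v 1 := by fun_prop
  have hr : ContDiff ℝ ∞ fun v => reg (ξ v) := contDiff_reg.comp hξ
  have hL : ContDiff ℝ ∞ fun v => δ v * z v 1 / reg (ξ v) :=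
    (hδ.mul h1).div hr fun v => (reg_pos _).ne'
  have hS : ContDiff ℝ ∞ fun v => sinc (δ v * z v 1 / reg (ξ v)) := contDiff_sinc.comp hL
  have hQ : ContDiff ℝ ∞ fun v => sincQ (δ v * z v 1 / reg (ξ v)) := contDiff_sincQ.comp hL
  have hC : ContDiff ℝ ∞ fun v => cos (δ v * z v 1 / reg (ξ v)) := contDiff_cos.comp hL
  have hA : ContDiff ℝ ∞ fun v => (reg (reg (ξ v) * cos (δ v * z v 1 / reg (ξ v)) +
      δ v * z v 0 * sinc (δ v * z v 1 / reg (ξ v))))⁻¹ :=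
    (contDiff_reg.comp ((hr.mul hC).add ((hδ.mul h0).mul hS))).inv fun v => (reg_pos _).ne'
  unfold amp
  refine (hA.pow m).mul (contDiff_cos.comp (hθ.add (((?_ : ContDiff ℝ ∞ _).add
    (?_ : ContDiff ℝ ∞ _)).add (?_ : ContDiff ℝ ∞ _))))
  · exact ((hr.mul h1).mul (contDiff_const.add (hC.mul hS))).mul contDiff_const
  · exact ((hr.mul h0).mul hL).mul (hS.pow 2)
  · exact (hδ.mul (h0.pow 2)).mul hQ

/-- In the limit `δ → 0` the surface becomes a flat cylinder. -/
theorem amp_zero (m : ℕ) (θ : ℝ) (z : Coord) : amp m 0 1 θ z = cos (θ + z 1) := by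
  have h : reg 1 = 1 := reg_eq (by norm_num)
  simp [amp, h, sincQ_zero]
  ring_nf

variable {f : ℝ → ℝ}

theorem testFn_expMap (hf : IsProfile f) (m : ℕ) (c : ℝ) {X ξ : ℝ} (hX : 5 ≤ X) (hξ : 1 / 2 ≤ ξ)
    (θ : ℝ) {z : Coord} (hz : elen z ≤ 8 / 5) :
    testFn f m c (expMap f (cov ![X * ξ, θ]) ![X⁻¹ * z 0, ξ * z 1]) =
      c * X⁻¹ ^ m * amp m (X ^ 2)⁻¹ ξ θ z := by
  have hX0 : 0 < X := by linarith
  have hξ0 : 0 < ξ := by linarith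
  have hXξ : 5 / 2 ≤ X * ξ := by nlinarith
  have hL : (ξ * z 1) / (X * ξ) ^ 2 = (X ^ 2)⁻¹ * z 1 / ξ := by field_simp
  set L := (X ^ 2)⁻¹ * z 1 / ξ with hLdef
  have hz0 : |X⁻¹ * z 0| ≤ 7 / 10 := by
    rw [abs_mul, abs_of_pos (by positivity : 0 < X⁻¹), inv_mul_le_iff₀ hX0]
    have := (abs_coord_le_elen z 0).trans hz
    linarith
  have hz1 : |L| ≤ 3 / 10 := by
    rw [hLdef, abs_div, abs_mul, abs_of_pos hξ0, abs_of_pos (by positivity : 0 < (X ^ 2)⁻¹),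
      div_le_iff₀ hξ0, inv_mul_le_iff₀ (by positivity)]
    have := (abs_coord_le_elen z 1).trans hz
    nlinarith
  have hexp := isExp_of_small hf (y := ![X * ξ, θ]) (v := ![X⁻¹ * z 0, ξ * z 1])
    (by simpa using hXξ) (by simpa using hz0) (by simpa [hL] using hz1)
  rw [expMap_eq hf hexp, testFn_cov]
  simp only [Matrix.cons_val_zero, Matrix.cons_val_one, Matrix.cons_val_fin_one, hL]
  have hhalf := half_le_farExp θ hXξ hz0 hz1
  have hfar0 : farExp (X * ξ) θ (X⁻¹ * z 0) L 0 =
      X * (ξ * cos L + (X ^ 2)⁻¹ * z 0 * sinc L) := by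
    simp [farExp]
    field_simp
  have hfar1 : farExp (X * ξ) θ (X⁻¹ * z 0) L 1 =
      θ + (ξ * z 1 * (1 + cos L * sinc L) * (1 / 2) + ξ * z 0 * L * sinc L ^ 2
        + (X ^ 2)⁻¹ * z 0 ^ 2 * sincQ L) := by
    have h1 : (X * ξ) ^ 2 * L = ξ * z 1 := by rw [hLdef]; field_simp
    have h2 : X * ξ * (X⁻¹ * z 0) = ξ * z 0 := by field_simp
    simp only [farExp, Matrix.cons_val_one, Matrix.cons_val_fin_one, h1, h2]
    rw [mul_pow, inv_pow]
  have hge : 1 ≤ farExp (X * ξ) θ (X⁻¹ * z 0) L 0 := by linarith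
  have hρ : 1 / 4 ≤ ξ * cos L + (X ^ 2)⁻¹ * z 0 * sinc L := by
    rw [hfar0] at hhalf
    have h3 : X * (ξ / 2) ≤ X * (ξ * cos L + (X ^ 2)⁻¹ * z 0 * sinc L) := by linarith
    have := le_of_mul_le_mul_left h3 hX0
    linarith
  rw [sqrt_far hf (hge.trans (le_abs_self _)), abs_of_nonneg (by linarith), hfar0, hfar1, amp,
    reg_eq (by linarith : 1 / 4 ≤ ξ), ← hLdef, reg_eq hρ, mul_inv, mul_pow]
  ring

/-- The smoothings of the test function, in rescaled variables. -/
theorem greenWu_testFn (hf : IsProfile f) {ψ : ℝ → ℝ} (hψ : IsKernel ψ) (m : ℕ) (c : ℝ)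
    {X ε : ℝ} (hX : 5 ≤ X) (hε : 0 < ε) (hεX : ε * X ≤ 8 / 5) {y : Coord}
    (hy : 1 / 2 ≤ y 0 / X) :
    greenWu f ψ (testFn f m c) ε (cov y) =
      c * X⁻¹ ^ m * ∫ z, weight ψ (ε * X) z * amp m (X ^ 2)⁻¹ (y 0 / X) (y 1) z := by
  have hX0 : 0 < X := by linarith
  set ξ := y 0 / X with hξ
  have hξ0 : 0 < ξ := by linarith
  have hy0 : y 0 = X * ξ := by rw [hξ]; field_simp
  have hyeq : y = ![X * ξ, y 1] := by
    ext i
    fin_cases i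
    · exact hy0
    · rfl
  have hR : 0 < ε * X := by positivity
  have hXξ : 1 ≤ |X * ξ| := by
    rw [abs_of_pos (by positivity)]
    nlinarith
  have hfX := (hf.deriv_far hXξ).1
  have hdet : Real.sqrt (metric f (cov y)).det = (X * ξ)⁻¹ := by
    have : (metric f (cov y)).det = f (X * ξ) := by
      simp [metric, cov, Matrix.det_fin_two, hy0]
    rw [this, sqrt_far hf hXξ, abs_of_pos (by positivity)]
  have hlen : ∀ z : Coord, vnorm f (cov y) ![X⁻¹ * z 0, ξ * z 1] / ε = elen z / (ε * X) := by
    intro z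
    rw [vnorm_eq, hy0, hfX]
    have : ((![X⁻¹ * z 0, ξ * z 1] : Coord) 0 ^ 2 +
        ((X * ξ) ^ 2)⁻¹ * (![X⁻¹ * z 0, ξ * z 1] : Coord) 1 ^ 2) =
        (X⁻¹) ^ 2 * (z 0 ^ 2 + z 1 ^ 2) := by
      simp
      field_simp
    rw [this, Real.sqrt_mul (by positivity), Real.sqrt_sq (by positivity), elen]
    field_simp
  rw [greenWu, integral_diag (a := X⁻¹) (b := ξ) (by positivity) hξ0, ← mul_assoc,
    ← integral_const_mul, ← integral_const_mul]
  refine integral_congr_ae (Eventually.of_forall fun z => ?_)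
  simp only [hdet, hlen]
  by_cases hz : elen z ≤ 8 / 5
  · have h := testFn_expMap hf m c hX hy (y 1) hz
    rw [← hyeq] at h
    rw [h, weight]
    field_simp
  · have h0 : weight ψ (ε * X) z = 0 := by
      by_contra hne
      exact hz ((elen_le_of_weight_ne_zero hψ hR hne).trans hεX)
    have h1 : ψ (elen z / (ε * X)) = 0 := by
      rw [weight] at h0
      exact (mul_eq_zero.1 h0).resolve_left (by positivity)
    rw [h0, h1]
    simp

end Rescaling

/-! ### Lower bound for the derivatives of the smoothings -/

section LowerBound

open Real

variable {f : ℝ → ℝ}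

/-- The values of the rescaled test function at the exponentials of a tangent vector `z` which is
moved along the geodesic that is horizontal at the point `(X, kπ/2)`, with `δ = X⁻²`. -/
def transport (m k : ℕ) (q : ℝ × (ℝ × Coord)) : ℝ :=
  amp m q.2.1 (cos (q.2.1 * q.1))
    (k * π / 2 + q.1 / 2 * (1 + sinc (q.2.1 * q.1) * cos (q.2.1 * q.1))) q.2.2

theorem contDiff_transport (m k : ℕ) : ContDiff ℝ ∞ (transport m k) := by
  have h1 : ContDiff ℝ ∞ fun q : ℝ × (ℝ × Coord) => q.2.1 * q.1 := by fun_prop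
  have h2 : ContDiff ℝ ∞ fun q : ℝ × (ℝ × Coord) => sinc (q.2.1 * q.1) := contDiff_sinc.comp h1
  exact contDiff_amp m (by fun_prop) (by fun_prop) (by fun_prop) (by fun_prop)

theorem iteratedDeriv_cos_add (k : ℕ) (a : ℝ) :
    iteratedDeriv k (fun s => cos (s + a)) = fun s => cos (s + a + k * π / 2) := by
  induction k with
  | zero => simp
  | succ k ih =>
    rw [iteratedDeriv_succ, ih]
    funext s
    have h : HasDerivAt (fun s => cos (s + a + k * π / 2)) _ s :=
      (((hasDerivAt_id s).add_const a).add_const (k * π / 2)).cos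
    rw [h.deriv, show s + a + ((k + 1 : ℕ) : ℝ) * π / 2 = s + a + k * π / 2 + π / 2 by
      push_cast; ring, cos_add_pi_div_two]
    simp

theorem iteratedDeriv_transport_zero (m k : ℕ) (z : Coord) :
    iteratedDeriv k (fun s => transport m k (s, (0, z))) 0 = (-1) ^ k * cos (z 1) := by
  have h : (fun s => transport m k (s, (0, z))) = fun s => cos (s + (k * π / 2 + z 1)) := by
    funext s
    simp only [transport, zero_mul, cos_zero, sinc_zero, amp_zero]
    ring_nf
  rw [h, iteratedDeriv_cos_add]
  show cos (0 + (k * π / 2 + z 1) + k * π / 2) = _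
  rw [← cos_add_nat_mul_pi]
  ring_nf

/-- For large `X` the `k`-th derivative of the averages is close to `± ∫ weight · cos z₁`, uniformly
in the kernel and the radius. -/
theorem eventually_le_iteratedDeriv (m k : ℕ) : ∀ᶠ X : ℝ in atTop, ∀ ψ, IsKernel ψ →
    ∀ R, 0 < R → R ≤ 8 / 5 → 1 / 4 ≤
      |iteratedDeriv k (fun s => ∫ z, weight ψ R z * transport m k (s, ((X ^ 2)⁻¹, z))) 0| := by
  have hδ : Tendsto (fun X : ℝ => (X ^ 2)⁻¹) atTop (𝓝 0) :=
    (tendsto_pow_atTop two_ne_zero).inv_tendsto_atTop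
  have hK : IsCompact (Metric.closedBall (0 : Coord) (8 / 5)) := isCompact_closedBall _ _
  filter_upwards [hδ.eventually (eventually_iteratedDeriv_close (contDiff_transport m k) k hK
    (by norm_num : (0 : ℝ) < 1 / 10))] with X hX ψ hψ R hR hR'
  set δ := (X ^ 2)⁻¹
  have hw := continuous_weight (R := R) hψ
  have hwc := hasCompactSupport_weight hψ hR
  have hF : ContDiff ℝ ∞ fun q : ℝ × Coord => transport m k (q.1, (δ, q.2)) :=
    (contDiff_transport m k).comp (by fun_prop)
  rw [iteratedDeriv_integral_weight (μ := volume) hw hwc hF]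
  set D : Coord → ℝ := fun z => iteratedDeriv k (fun s => transport m k (s, (δ, z))) 0 with hD
  have hDc : Continuous D := by
    have h1 := (contDiff_iterate_dfst hF k).continuous.comp (Continuous.prodMk_right (Y := Coord) 0)
    refine h1.congr fun z => ?_
    exact (congrFun (iteratedDeriv_eq_iterate_dfst hF k z) 0).symm
  have hi1 := integrable_weight_mul hψ hR hDc
  have hi2 := integrable_weight_mul hψ hR (g := fun z => (-1) ^ k * cos (z 1)) (by fun_prop)
  have hdiff : |(∫ z, weight ψ R z * D z) - ∫ z : Coord, weight ψ R z * ((-1) ^ k * cos (z 1))| ≤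
      1 / 10 := by
    rw [← integral_sub hi1 hi2]
    calc |∫ z : Coord, (weight ψ R z * D z - weight ψ R z * ((-1) ^ k * cos (z 1)))|
        ≤ ∫ z : Coord, |weight ψ R z * D z - weight ψ R z * ((-1) ^ k * cos (z 1))| :=
          abs_integral_le_integral_abs
      _ ≤ ∫ z : Coord, weight ψ R z * (1 / 10) := by
          refine integral_mono (hi1.sub hi2).abs ((integrable_weight hψ hR).mul_const _) fun z => ?_
          show |weight ψ R z * D z - weight ψ R z * ((-1) ^ k * cos (z 1))| ≤ _
          rw [← mul_sub, abs_mul, abs_of_nonneg (weight_nonneg hψ z)]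
          by_cases hz : weight ψ R z = 0
          · simp [hz]
          · refine mul_le_mul_of_nonneg_left ?_ (weight_nonneg hψ z)
            have hzK : z ∈ Metric.closedBall (0 : Coord) (8 / 5) := by
              rw [mem_closedBall_zero_iff, pi_norm_le_iff_of_nonneg (by norm_num)]
              exact fun i => (abs_coord_le_elen z i).trans
                ((elen_le_of_weight_ne_zero hψ hR hz).trans hR')
            have := hX z hzK
            rw [iteratedDeriv_transport_zero] at this
            exact this.le
      _ = 1 / 10 := by rw [integral_mul_const, integral_weight hψ hR, one_mul]
  have hmain : 9 / 25 ≤ |∫ z : Coord, weight ψ R z * ((-1) ^ k * cos (z 1))| := by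
    have h1 : ∀ z : Coord, weight ψ R z * ((-1) ^ k * cos (z 1)) =
        (-1) ^ k * (weight ψ R z * cos (z 1)) := fun z => by ring
    simp only [h1]
    rw [integral_const_mul, abs_mul, abs_pow, abs_neg, abs_one, one_pow, one_mul]
    exact (le_integral_weight_cos hψ hR hR').trans (le_abs_self _)
  -- `9/25 - 1/10 > 1/4`
  have htri := abs_sub_abs_le_abs_sub (∫ z : Coord, weight ψ R z * ((-1) ^ k * cos (z 1)))
    (∫ z, weight ψ R z * D z)
  rw [abs_sub_comm] at htri
  linarith

theorem contDiff_integral_amp {ψ : ℝ → ℝ} (hψ : IsKernel ψ) {R : ℝ} (hR : 0 < R) (m : ℕ)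
    (δ X : ℝ) :
    ContDiff ℝ ∞ fun y : Coord => ∫ z, weight ψ R z * amp m δ (y 0 / X) (y 1) z := by
  rw [contDiff_infty]
  intro n
  exact contDiff_integral_weight (μ := volume) (continuous_weight hψ)
    (hasCompactSupport_weight hψ hR) n
    (F := fun q : Coord × Coord => amp m δ (q.1 0 / X) (q.1 1) q.2)
    (contDiff_amp m (by fun_prop) (by fun_prop) (by fun_prop) (by fun_prop))

/-- The smoothings of the test function are smooth. Up to constants, the norms of their `k`-th
covariant derivatives are at least the amplitude `X⁻ᵐ` of the test function divided by the `k`-th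
power of the length `2π / X` of the circle. -/
theorem eventually_le_covDerivNorm (hf : IsProfile f) (m k : ℕ) {c : ℝ} (hc : 0 < c) :
    ∀ᶠ X : ℝ in atTop, ∀ ψ, IsKernel ψ → ∀ ε, 0 < ε → ε * X ≤ 8 / 5 →
      ContDiffAt ℝ ∞ (fun y => greenWu f ψ (testFn f m c) ε (cov y)) ![X, k * π / 2] ∧
      X ^ k * (c * X⁻¹ ^ m * (1 / 4)) ≤
        covDerivNorm f (greenWu f ψ (testFn f m c) ε) k ![X, k * π / 2] := by
  filter_upwards [eventually_le_iteratedDeriv m k, eventually_ge_atTop 5]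
    with X hbig hX ψ hψ ε hε hεX
  have hX0 : 0 < X := by linarith
  have hR : 0 < ε * X := by positivity
  set P : Coord := ![X, k * π / 2] with hP
  set δ := (X ^ 2)⁻¹ with hδ
  have hδ0 : δ ≠ 0 := by positivity
  set h := greenWu f ψ (testFn f m c) ε with hh
  set Ω : Set Coord := {y | 1 / 2 < y 0 / X} with hΩdef
  have hΩ : IsOpen Ω := isOpen_lt continuous_const (by fun_prop)
  have hformula : EqOn (fun y => h (cov y)) (fun y => c * X⁻¹ ^ m *
      ∫ z, weight ψ (ε * X) z * amp m δ (y 0 / X) (y 1) z) Ω := fun y hy =>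
    greenWu_testFn hf hψ m c hX hε hεX (le_of_lt hy)
  have hsm : ContDiffOn ℝ ∞ (fun y => h (cov y)) Ω :=
    (contDiff_const.mul (contDiff_integral_amp hψ hR m δ X)).contDiffOn.congr hformula
  have hPΩ : P ∈ Ω := by
    show 1 / 2 < X / X
    rw [div_self hX0.ne']
    norm_num
  refine ⟨hsm.contDiffAt (hΩ.mem_nhds hPΩ), ?_⟩
  -- the horizontal geodesic through `P`, run so that its velocity there is `∂/∂θ`
  set γ : ℝ → Coord := farGeod X (k * π / 2) 0 δ with hγ
  set w : ℝ → Coord := farVel X 0 δ with hw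
  have hγ0 : γ 0 = P := by
    ext i
    fin_cases i <;> simp [hγ, farGeod, hP]
  have hγx : ∀ s, γ s 0 = X * cos (δ * s) := fun s => by simp [hγ, farGeod]
  have hγθ : ∀ s, γ s 1 = k * π / 2 + s / 2 * (1 + sinc (δ * s) * cos (δ * s)) := by
    intro s
    have h1 : X ^ 2 * (δ * s) = s := by rw [hδ]; field_simp
    have h2 : γ s 1 = k * π / 2 + X ^ 2 * (δ * s + cos (δ * s) * sin (δ * s)) / 2 := by
      simp [hγ, farGeod]
    rw [h2, ← mul_sinc (δ * s)]
    linear_combination (1 / 2 + cos (δ * s) * sinc (δ * s) / 2) * h1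
  set J : Set ℝ := {s | 1 / 2 < cos (δ * s)} with hJdef
  have hJ : IsOpen J := isOpen_lt continuous_const (by fun_prop)
  have h0J : (0 : ℝ) ∈ J := by
    show 1 / 2 < cos (δ * 0)
    norm_num
  have hfar : ∀ s ∈ J, 1 ≤ |γ s 0| := by
    intro s hs
    have hs' : 1 / 2 < cos (δ * s) := hs
    rw [hγx, abs_of_pos (by positivity)]
    nlinarith
  have hgeo := iteratedDeriv_along_geodesic hf hΩ hsm (γ := γ) (w := w) hJ
    (fun s _ => hasDerivAt_farGeod X _ 0 s hδ0)
    (fun s hs => hasDerivAt_farVel hf X _ 0 hδ0 (hfar s hs))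
    (fun s hs => by
      show 1 / 2 < γ s 0 / X
      rw [hγx, mul_div_cancel_left₀ _ hX0.ne']
      exact hs) k 0 h0J
  have hsum : ∑ I : Fin k → Fin 2, (∏ i, w 0 (I i)) * covDeriv f h k I (γ 0) =
      covDeriv f h k (fun _ => 1) P := by
    have hw0 : w 0 0 = 0 := by simp [hw, farVel]
    have hw1 : w 0 1 = 1 := by
      simp [hw, farVel, hδ]
      field_simp
    rw [hγ0, Finset.sum_eq_single fun _ => (1 : Fin 2)]
    · simp [hw1]
    · intro I _ hI
      obtain ⟨i, hi⟩ := Function.ne_iff.1 hI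
      have hi0 : I i = 0 := by
        have : I i ≠ 1 := hi
        omega
      rw [Finset.prod_eq_zero (Finset.mem_univ i) (by rw [hi0, hw0]), zero_mul]
    · simp
  have hcurve : (fun s => h (cov (γ s))) =ᶠ[𝓝 0] fun s => c * X⁻¹ ^ m *
      ∫ z, weight ψ (ε * X) z * transport m k (s, (δ, z)) := by
    filter_upwards [hJ.mem_nhds h0J] with s hs
    have h1 : γ s 0 / X = cos (δ * s) := by rw [hγx, mul_div_cancel_left₀ _ hX0.ne']
    have h2 : γ s ∈ Ω := by
      show 1 / 2 < γ s 0 / X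
      rw [h1]
      exact hs
    have h3 := hformula h2
    simp only [h1, hγθ s] at h3
    exact h3
  have hval : |covDeriv f h k (fun _ => 1) P| = c * X⁻¹ ^ m *
      |iteratedDeriv k (fun s => ∫ z, weight ψ (ε * X) z * transport m k (s, (δ, z))) 0| := by
    rw [← hsum, ← hgeo, hcurve.iteratedDeriv_eq, iteratedDeriv_const_mul_field, abs_mul,
      abs_of_pos (by positivity)]
  have hP0 : |P 0| = X := abs_of_pos hX0
  have hle := le_covDerivNorm hf h k (y := P) (by rw [hP0]; linarith)
  rw [hP0, hval] at hle
  refine le_trans ?_ hle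
  have := hbig ψ hψ (ε * X) hR hεX
  gcongr

/-- The smoothings of a test function have unbounded `k`-th derivatives if `m < k`. -/
theorem smoothing_unbounded (hf : IsProfile f) {m k : ℕ} (hmk : m < k) {c : ℝ} (hc : 0 < c) :
    ∃ P : ℕ → Coord, Tendsto (fun j => |P j 0|) atTop atTop ∧
      (∀ j, 0 < injRad f (cov (P j))) ∧
      ∀ ψ : ℝ → ℝ, IsKernel ψ → ∀ C : ℝ, ∀ᶠ j in atTop, ∀ ε : ℝ, 0 < ε →
        ENNReal.ofReal (2 * ε) < injRad f (cov (P j)) →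
          ContDiffAt ℝ ∞ (fun y => greenWu f ψ (testFn f m c) ε (cov y)) (P j) ∧
          C < covDerivNorm f (greenWu f ψ (testFn f m c) ε) k (P j) := by
  have hx : Tendsto (fun j : ℕ => (j : ℝ) + 5) atTop atTop :=
    tendsto_atTop_add_const_right _ _ tendsto_natCast_atTop_atTop
  have h5 : ∀ j : ℕ, (5 : ℝ) ≤ (j : ℝ) + 5 := fun j => by
    have : (0 : ℝ) ≤ j := Nat.cast_nonneg j
    linarith
  refine ⟨fun j => ![(j : ℝ) + 5, k * π / 2], tendsto_abs_atTop_atTop.comp hx,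
    fun j => injRad_pos hf (h5 j), fun ψ hψ C => ?_⟩
  filter_upwards [hx.eventually (eventually_le_covDerivNorm hf m k hc),
    hx.eventually (eventually_gt_atTop (4 * C / c))] with j hj hjC ε hε hinj
  set X := (j : ℝ) + 5
  have hX : 5 ≤ X := h5 j
  have hX0 : 0 < X := by linarith
  have hεX : ε * X ≤ 8 / 5 := by
    have h1 := hinj.trans_le (injRad_le hf (y := ![X, k * π / 2])
      (show 5 ≤ |X| from hX.trans (le_abs_self X)))
    rw [ENNReal.ofReal_lt_ofReal_iff'] at h1
    have h2 : 2 * ε < 16 / 5 / |X| := h1.1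
    rw [abs_of_pos hX0, lt_div_iff₀ hX0] at h2
    linarith
  obtain ⟨hsm, hle⟩ := hj ψ hψ ε hε hεX
  refine ⟨hsm, lt_of_lt_of_le ?_ hle⟩
  have hpow : X ≤ X ^ k * X⁻¹ ^ m := by
    obtain ⟨n, rfl⟩ := Nat.exists_eq_add_of_lt hmk
    have h1 : X ^ (m + n + 1) * X⁻¹ ^ m = X ^ n * X := by
      rw [pow_succ, pow_add, inv_pow]
      field_simp
    rw [h1]
    exact le_mul_of_one_le_left hX0.le (one_le_pow₀ (by linarith))
  calc C < X * c / 4 := by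
        rw [div_lt_iff₀ hc] at hjC
        linarith
    _ ≤ (X ^ k * X⁻¹ ^ m) * c / 4 := by gcongr
    _ = X ^ k * (c * X⁻¹ ^ m * (1 / 4)) := by ring

end LowerBound

end Cyl

end

theorem mainTheorem9 (f : ℝ → ℝ) (hf : Cyl.IsProfile f) :
    -- completeness
    Cyl.IsCompleteMetric f ∧
    -- curvature for `|x| ≥ 1`
    (∀ y : Cyl.Coord, 1 ≤ |y 0| →
      Cyl.Rlow f 0 1 0 1 y = 2 / y 0 ^ 4 ∧
      Cyl.rmSq f y = 8 / y 0 ^ 4 ∧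
      Cyl.rmFullSq f y = 16 / y 0 ^ 4) ∧
    -- bounded curvature
    (∃ k₀ : ℝ, 0 < k₀ ∧ ∀ y : Cyl.Coord, Real.sqrt (Cyl.rmSq f y) ≤ k₀) ∧
    -- the injectivity radius tends to zero as `|x| → ∞`
    Tendsto (Cyl.injRad f) (comap (fun p : Cyl.M => |p.2|) atTop) (𝓝 0) ∧
    -- Green–Wu smoothings with admissible radii do not have uniformly bounded derivatives
    (∀ k : ℕ, 1 ≤ k → ∃ u : Cyl.M → ℝ,
      Continuous u ∧ (∃ B : ℝ, ∀ p, |u p| ≤ B) ∧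
      (2 ≤ k → ∀ p q, |u p - u q| ≤ Cyl.rdist f p q) ∧
      ∃ P : ℕ → Cyl.Coord, Tendsto (fun j => |P j 0|) atTop atTop ∧
        (∀ j, 0 < Cyl.injRad f (Cyl.cov (P j))) ∧
        ∀ ψ : ℝ → ℝ, Cyl.IsKernel ψ → ∀ C : ℝ, ∀ᶠ j in atTop, ∀ ε : ℝ, 0 < ε →
          ENNReal.ofReal (2 * ε) < Cyl.injRad f (Cyl.cov (P j)) →
            ContDiffAt ℝ ∞ (fun y => Cyl.greenWu f ψ u ε (Cyl.cov y)) (P j) ∧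
            C < Cyl.covDerivNorm f (Cyl.greenWu f ψ u ε) k (P j)) := by
  refine ⟨Cyl.isCompleteMetric hf, Cyl.curvature_far hf, Cyl.curvature_bounded hf,
    Cyl.tendsto_injRad hf, fun k hk => ?_⟩
  rcases hk.eq_or_lt with rfl | hk2
  · exact ⟨Cyl.testFn f 0 1, Cyl.continuous_testFn hf 0 1, Cyl.testFn_bounded hf 0 1,
      fun h => absurd h (by norm_num), Cyl.smoothing_unbounded hf one_pos one_pos⟩
  · obtain ⟨c, hc, hLip⟩ := Cyl.exists_lipschitz_testFn hf
    exact ⟨Cyl.testFn f 1 c, Cyl.continuous_testFn hf 1 c, Cyl.testFn_bounded hf 1 c,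
      fun _ => hLip, Cyl.smoothing_unbounded hf hk2 hc⟩
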